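/- **Setting.** Let $A\in\mathbb{R}^{n\times d}$ have rows $a_1,\dots,a_n$, let $\Sigma=A^\top A$ have eigenvalues $\lambda_1\ge\dots\ge\lambda_d$, and let $v_1$ be a unit eigenvector for $\lambda_1$. Put $\mathrm{gap}=(\lambda_1-\lambda_2)/\lambda_1$ and $\mathrm{srank}(A)=\|A\|_F^2/\lambda_1$, and let $\mathrm{nnz}(A)$ be the number of nonzero entries of $A$. Time is the number of real-arithmetic operations (arithmetic, comparison, square root, logarithm, rounding, loop counter) and random draws (a standard Gaussian, a uniform integer, or an index from a distribution prepared for sampling), each counted as one step. **Method.** The input is $A$, $\varepsilon$, a shift $\lambda$ and an estimate $\hat\lambda_1$ of $\lambda_1$. Let $B=\lambda I-A^\top A$, $\hat\mu=\lambda-\hat\lambda_1$, $\hat g=100\,\hat\mu/\hat\lambda_1$, $\gamma=\sqrt{d\hat\lambda_1\|A\|_F^2/\mathrm{nnz}(A)}$, $\rho=(2\gamma+\hat\mu)/\hat\mu$, $\bar S=(\gamma^2+12\hat\lambda_1\|A\|_F^2)/(2(\hat\mu+\gamma))$, $\eta=1/(8\bar S)$ and $p_i=\|a_i\|^2/\|A\|_F^2$.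 Let $K$ be a natural number (a constant). * *SVRG epoch* with reference point $w$, for $f_{\gamma,y}(x)=\frac12x^\top Bx-b^\top x+\frac\gamma2\|x-y\|^2=\sum_i\psi_i(x)$, where $\psi_i(x)=\frac12x^\top(\lambda p_iI-a_ia_i^\top)x-\frac1nb^\top x+\frac{\gamma p_i}2\|x-y\|^2$: draw $m$ uniformly from $\{1,\dots,\lfloor 64\bar S/(\hat\mu+\gamma)\rfloor+1\}$, and starting from $x=w$ do $m$ times: draw $i$ with probability $p_i$ and set $x\leftarrow x-\frac{\eta}{p_i}(\nabla\psi_i(x)-\nabla\psi_i(w))-\eta\nabla f_{\gamma,y}(w)$. * *Accelerated SVRG* for $Bz=b$ from $z_0$: start with $x=v=z_0$, put $\alpha=\rho^{-1/2}$, and do $\lceil K\sqrt\rho\rceil$ times: $y=\frac{x+\alpha v}{1+\alpha}$; let $x^+$ be the result of $\lceil K\log\rho\rceil$ successive SVRG epochs for $f_{\gamma,y}$ started at $y$; $v\leftarrow(1-\alpha)v+\alpha\bigl(y-(\tfrac2{\hat\mu}+\tfrac1\gamma)\gamma(y-x^+)\bigr)$; $x\leftarrow x^+$. Return $x$. * $\mathrm{solve}_r(x)$: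 $r$ successive runs of accelerated SVRG for $Bz=x$, the first one started at $x/(x^\top Bx)$. * *Power method*: draw $x_0\sim\mathcal N(0,I_d)$ and set $x=x_0/\|x_0\|$. Then $\lceil K\log(d/\hat g)\rceil$ times set $z=\mathrm{solve}_r(x)$ with $r=\lceil K\log(d/\hat g)\rceil$, and $x\leftarrow z/\|z\|$. Then $\lceil K\log(d/\varepsilon)\rceil$ times set $z=\mathrm{solve}_K(x)$, and replace $x$ by $z/\|z\|$ if $\frac{z^\top\Sigma z}{z^\top z}\ge\hat\lambda_1-\frac{\lambda-\hat\lambda_1}6$ and $\|z\|\ge\frac23\cdot\frac1{\lambda-\hat\lambda_1}$. Return $x$. **Theorem (Shifted-and-Inverted Power Method Using Accelerated SVRG).** There are absolute constants $K\in\mathbb N$ and $C>0$ such that the following holds for all $n$, all $d\ge2$, all $A\in\mathbb{R}^{n\times d}$ with $\mathrm{gap}>0$ and $d\le\mathrm{nnz}(A)\le \frac{d\,\mathrm{srank}(A)}{\mathrm{gap}^2}$, all $\varepsilon\in(0,1)$, all $\lambda$ with $(1+\frac{\mathrm{gap}}{150})\lambda_1\le\lambda\le(1+\frac{\mathrm{gap}}{100})\lambda_1$,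 and all $\hat\lambda_1$ with $\frac{10}{11}(\lambda-\lambda_1)\le\lambda-\hat\lambda_1\le\lambda-\lambda_1$ (for example $\hat\lambda_1=\lambda_1$). With probability at least $1-C/d^{10}$ the method returns a unit vector $x$ with $|v_1^\top x|\ge1-\varepsilon$, and for every outcome of the random draws its total time is at most $$C\cdot\frac{\mathrm{nnz}(A)^{3/4}\,(d\,\mathrm{srank}(A))^{1/4}}{\sqrt{\mathrm{gap}}}\left(\log^3\frac d{\mathrm{gap}}+\log\frac d{\mathrm{gap}}\,\log\frac1\varepsilon\right).$$ -/

import Mathlib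

open scoped ENNReal Matrix

noncomputable section

namespace ShiftInvert

/-- `ℝᵈ` with the Euclidean norm. -/
abbrev Vec (d : ℕ) : Type := EuclideanSpace ℝ (Fin d)

/-! ### Parameters of a real matrix -/

/-- The number of nonzero entries of `A`. -/
def nnz {n d : ℕ} (A : Matrix (Fin n) (Fin d) ℝ) : ℕ :=
  (Finset.univ.filter fun p : Fin n × Fin d => A p.1 p.2 ≠ 0).card

/-- The number of nonzero entries of the `i`-th row of `A`. -/
def rowNnz {n d : ℕ} (A : Matrix (Fin n) (Fin d) ℝ) (i : Fin n) : ℕ :=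
  (Finset.univ.filter fun j : Fin d => A i j ≠ 0).card

/-- The squared Euclidean norm of the `i`-th row. -/
def rowSq {n d : ℕ} (A : Matrix (Fin n) (Fin d) ℝ) (i : Fin n) : ℝ := ∑ j, A i j ^ 2

/-- The squared Frobenius norm. -/
def frobSq {n d : ℕ} (A : Matrix (Fin n) (Fin d) ℝ) : ℝ := ∑ i, rowSq A i

/-- The `i`-th row `aᵢ`, as a vector. -/
def row {n d : ℕ} (A : Matrix (Fin n) (Fin d) ℝ) (i : Fin n) : Vec d := WithLp.toLp 2 (A i)

/-- The action `x ↦ Σ x` of the Gram matrix `Σ = Aᵀ A`. -/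
def gramMul {n d : ℕ} (A : Matrix (Fin n) (Fin d) ℝ) (x : Vec d) : Vec d :=
  WithLp.toLp 2 (Aᵀ *ᵥ (A *ᵥ x.ofLp))

theorem gram_isHermitian {n d : ℕ} (A : Matrix (Fin n) (Fin d) ℝ) : (Aᵀ * A).IsHermitian := by
  simpa using Matrix.isHermitian_conjTranspose_mul_self A

/-- The eigenvalues of `Σ = Aᵀ A` with multiplicity, in decreasing order and numbered from `0`:
`eig A 0` is `λ₁` and `eig A 1` is `λ₂`. -/
def eig {n d : ℕ} (A : Matrix (Fin n) (Fin d) ℝ) (k : ℕ) : ℝ :=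
  if h : k < d then (gram_isHermitian A).eigenvalues₀ ⟨k, by simpa using h⟩ else 0

/-- The relative eigenvalue gap `(λ₁ - λ₂) / λ₁`. -/
def gap {n d : ℕ} (A : Matrix (Fin n) (Fin d) ℝ) : ℝ := (eig A 0 - eig A 1) / eig A 0

/-- The stable rank `‖A‖_F² / ‖A‖₂²`, where `‖A‖₂² = λ₁`. -/
def srank {n d : ℕ} (A : Matrix (Fin n) (Fin d) ℝ) : ℝ := frobSq A / eig A 0

theorem frobSq_pos {n d : ℕ} {A : Matrix (Fin n) (Fin d) ℝ} (hA : A ≠ 0) : 0 < frobSq A := by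
  obtain ⟨i, j, hij⟩ : ∃ i j, A i j ≠ 0 := by
    by_contra h
    push Not at h
    exact hA (Matrix.ext h)
  have hrow : ∀ k, 0 ≤ rowSq A k := fun k => Finset.sum_nonneg fun _ _ => sq_nonneg _
  have h1 : A i j ^ 2 ≤ rowSq A i :=
    Finset.single_le_sum (f := fun j => A i j ^ 2) (fun _ _ => sq_nonneg _) (Finset.mem_univ j)
  have h2 : rowSq A i ≤ frobSq A :=
    Finset.single_le_sum (f := rowSq A) (fun k _ => hrow k) (Finset.mem_univ i)
  have h3 : 0 < A i j ^ 2 := by positivity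
  linarith

/-- The distribution `pᵢ = ‖aᵢ‖² / ‖A‖_F²` on the rows of a nonzero matrix. -/
def rowPMF {n d : ℕ} (A : Matrix (Fin n) (Fin d) ℝ) (hA : A ≠ 0) : PMF (Fin n) :=
  PMF.ofFintype (fun i => ENNReal.ofReal (rowSq A i / frobSq A)) (by
    have hrow : ∀ i, 0 ≤ rowSq A i := fun i => Finset.sum_nonneg fun _ _ => sq_nonneg _
    rw [← ENNReal.ofReal_sum_of_nonneg fun i _ => div_nonneg (hrow i) (frobSq_pos hA).le,
      ← Finset.sum_div]
    change ENNReal.ofReal (frobSq A / frobSq A) = 1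
    rw [div_self (frobSq_pos hA).ne', ENNReal.ofReal_one])

/-! ### Randomized computations with a step count

A randomized computation is a law on pairs (result, number of steps). One step is one operation of
a real-arithmetic machine with random access: `+`, `-`, `*`, `/`, a square root, a logarithm,
a rounding, a comparison, the update of a loop counter, or one random draw (a standard Gaussian,
a uniform integer, or an index from a distribution prepared for sampling, as by an alias table).
Sequencing adds the steps. -/

/-- Randomized computations returning a value in `α`, with their step count. -/
def Comp (α : Type) : Type := PMF (α × ℕ)

namespace Comp

instance : Monad Comp where
  pure a := PMF.pure (a, 0)
  bind m f := PMF.bind m fun r => PMF.map (fun s => (s.1, r.2 + s.2)) (f r.1)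

/-- Compute the value `a` in `c` steps. -/
def paid {α : Type} (c : ℕ) (a : α) : Comp α := PMF.pure (a, c)

/-- Draw from the law `p`, in one step. -/
def draw {α : Type} (p : PMF α) : Comp α := PMF.map (fun a => (a, 1)) p

/-- Run the loop body `f` exactly `k` times, starting from `a`; each round pays one step for
the loop counter. -/
def loop {α : Type} (f : α → Comp α) : ℕ → α → Comp α
  | 0, a => pure a
  | k + 1, a => do
    let b ← f a
    let b ← paid 1 b
    loop f k b

/-- The possible pairs (result, number of steps). -/
def outcomes {α : Type} (m : Comp α) : Set (α × ℕ) := PMF.support m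

/-- The probability that the result lies in `S`. -/
def prob {α : Type} (m : Comp α) (S : Set α) : ℝ≥0∞ :=
  PMF.toOuterMeasure m (Prod.fst ⁻¹' S)

end Comp

/-! ### The algorithm -/

/-- What the algorithm is given: a nonzero matrix `A`, the shift `lam`, an estimate `lamHat` of
the top eigenvalue `λ₁` of `Σ = Aᵀ A`, and the accuracy `eps`. -/
structure Input (n d : ℕ) where
  A : Matrix (Fin n) (Fin d) ℝ
  nonzero : A ≠ 0
  lam : ℝ
  lamHat : ℝ
  eps : ℝ

namespace Input

variable {n d : ℕ} (I : Input n d)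

/-- The action of the shifted matrix `B = lam • 1 - Aᵀ A`. -/
def shiftMul (x : Vec d) : Vec d := I.lam • x - gramMul I.A x

/-- Estimate of the strong convexity parameter `lam - λ₁` of `w ↦ ½ wᵀ B w - bᵀ w`. -/
def mu : ℝ := I.lam - I.lamHat

/-- Estimate of the gap, up to a constant factor. -/
def gapHat : ℝ := 100 * (I.lam - I.lamHat) / I.lamHat

/-- The regularization parameter of the proximal subproblems. -/
def gamma : ℝ := √(d * I.lamHat * frobSq I.A / nnz I.A)

/-- The variance parameter of the regularized problem. -/
def variance : ℝ :=
  (I.gamma ^ 2 + 12 * I.lamHat * frobSq I.A) / (2 * (I.mu + I.gamma))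

/-- The step size of SVRG. -/
def eta : ℝ := 1 / (8 * I.variance)

/-- One less than the maximal number of stochastic steps in an epoch of SVRG. -/
def epochMax : ℕ := ⌊64 * I.variance / (I.mu + I.gamma)⌋₊

/-- `(2γ + μ) / μ`, the condition number that governs the acceleration. -/
def rho : ℝ := (2 * I.gamma + I.mu) / I.mu

/-- The probability `pᵢ = ‖aᵢ‖² / ‖A‖_F²`, as a real number. -/
def p (i : Fin n) : ℝ := rowSq I.A i / frobSq I.A

/-- The gradient at `x` of the (possibly non-convex) component
`ψᵢ(x) = ½ xᵀ (lam pᵢ - aᵢ aᵢᵀ) x - (1/n) bᵀ x + ½ γ pᵢ ‖x - y‖²`. -/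
def psiGrad (b y : Vec d) (i : Fin n) (x : Vec d) : Vec d :=
  (I.lam * I.p i) • x - (inner ℝ (row I.A i) x) • row I.A i - (1 / (n : ℝ)) • b
    + (I.gamma * I.p i) • (x - y)

/-- The gradient at `x` of `∑ᵢ ψᵢ(x) = ½ xᵀ B x - bᵀ x + ½ γ ‖x - y‖²`. -/
def fullGrad (b y x : Vec d) : Vec d := I.shiftMul x - b + I.gamma • (x - y)

/-- One stochastic step from the iterate `x` in an epoch with reference point `w`, where `g` is the
full gradient at `w`:
`x ← x - (η / pᵢ) (∇ψᵢ(x) - ∇ψᵢ(w)) - η g` with `i` drawn with probability `pᵢ`.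
A component gradient takes `4 nnz(aᵢ) + 6d + 5` steps. -/
def svrgStep (b y w g x : Vec d) : Comp (Vec d) := do
  let i ← Comp.draw (rowPMF I.A I.nonzero)
  let s ← Comp.paid (4 * rowNnz I.A i + 6 * d + 5) (I.psiGrad b y i x)
  let t ← Comp.paid (4 * rowNnz I.A i + 6 * d + 5) (I.psiGrad b y i w)
  Comp.paid (5 * d + 2) (x - (I.eta / I.p i) • (s - t) - I.eta • g)

/-- One epoch of SVRG with reference and starting point `w`, for
`½ xᵀ B x - bᵀ x + ½ γ ‖x - y‖²`: the number of stochastic steps is uniform on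
`{1, …, epochMax + 1}`. -/
def svrgEpoch (b y w : Vec d) : Comp (Vec d) := do
  let g ← Comp.paid (4 * nnz I.A + 6 * d) (I.fullGrad b y w)
  let k ← Comp.draw (PMF.uniformOfFintype (Fin (I.epochMax + 1)))
  Comp.loop (I.svrgStep b y w g) (k.val + 1) w

/-- Approximate proximal step at the centre `y`: `⌈K log ρ⌉` epochs of SVRG, started at `y`. -/
def proxStep (K : ℕ) (b y : Vec d) : Comp (Vec d) :=
  Comp.loop (I.svrgEpoch b y) ⌈K * Real.log I.rho⌉₊ y

/-- One step of the accelerated approximate proximal point method, on pairs `(x, v)`, with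
momentum parameter `ρ ^ (-1/2)`. -/
def accelStep (K : ℕ) (b : Vec d) (s : Vec d × Vec d) : Comp (Vec d × Vec d) := do
  let α ← Comp.paid 2 (1 / √I.rho)
  let y ← Comp.paid (3 * d + 4) ((1 / (1 + α)) • s.1 + (α / (1 + α)) • s.2)
  let x ← I.proxStep K b y
  let g ← Comp.paid (2 * d) (I.gamma • (y - x))
  let v ← Comp.paid (5 * d + 5)
    ((1 - α) • s.2 + α • (y - (1 / (I.mu / 2) + 1 / I.gamma) • g))
  pure (x, v)

/-- Accelerated SVRG for the system `B z = b`, started at `z`: `⌈K √ρ⌉` accelerated steps. -/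
def accelSolve (K : ℕ) (b z : Vec d) : Comp (Vec d) := do
  let s ← Comp.loop (I.accelStep K b) ⌈K * √I.rho⌉₊ (z, z)
  pure s.1

/-- Approximation of `B⁻¹ x`: `r` successive runs of the accelerated solver on `B z = x`, the first
one started at `(1 / xᵀ B x) x`. -/
def solve (K r : ℕ) (x : Vec d) : Comp (Vec d) := do
  let z ← Comp.paid (4 * nnz I.A + 5 * d + 1) ((1 / inner ℝ x (I.shiftMul x)) • x)
  Comp.loop (I.accelSolve K x) r z

/-- `z / ‖z‖`. -/
def normalize (z : Vec d) : Comp (Vec d) := Comp.paid (3 * d + 2) ((1 / ‖z‖) • z)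

/-- The number `⌈K log (d / gapHat)⌉`. -/
def burnInCount (K : ℕ) : ℕ := ⌈K * Real.log (d / I.gapHat)⌉₊

/-- One inverted power iteration of the burn-in phase. -/
def burnInStep (K : ℕ) (x : Vec d) : Comp (Vec d) := do
  let z ← I.solve K (I.burnInCount K) x
  normalize z

/-- The Rayleigh quotient `xᵀ Σ x / xᵀ x`. -/
def quot (x : Vec d) : ℝ := inner ℝ x (gramMul I.A x) / inner ℝ x x

open Classical in
/-- One inverted power iteration of the main phase: the update is accepted only if its Rayleigh
quotient and its norm are large enough. -/
def warmStep (K : ℕ) (x : Vec d) : Comp (Vec d) := do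
  let z ← I.solve K K x
  let accept ← Comp.paid (4 * nnz I.A + 4 * d + 10)
    (decide (I.lamHat - (I.lam - I.lamHat) / 6 ≤ I.quot z ∧
      2 / 3 * (1 / (I.lam - I.lamHat)) ≤ ‖z‖))
  if accept then normalize z else pure x

/-- The shifted-and-inverted power method with the accelerated SVRG solver, run from the Gaussian
vector `g`. All iteration counts have the constant `K` in front. The first line pays for the
computation of `nnz(A)`, of the row norms, of `‖A‖_F²`, of the `pᵢ`, of the sampling table and of
the scalar parameters; the second one for the draw of the `d` coordinates of `g` and for
`g / ‖g‖`. -/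
def powerMethod (K : ℕ) (g : Vec d) : Comp (Vec d) := do
  let _ ← Comp.paid (10 * nnz I.A + 100) ()
  let g ← Comp.paid d g
  let x ← normalize g
  let x ← Comp.loop (I.burnInStep K) (I.burnInCount K) x
  Comp.loop (I.warmStep K) ⌈K * Real.log (d / I.eps)⌉₊ x

/-- The probability that the method returns a vector in `S`, over `g ∼ N(0, 1)` in `ℝᵈ` and the
internal randomness. -/
def successProb (K : ℕ) (S : Set (Vec d)) : ℝ≥0∞ :=
  ∫⁻ g, (I.powerMethod K g).prob S ∂(ProbabilityTheory.stdGaussian (Vec d))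

end Input

end ShiftInvert

end

noncomputable section

namespace ShiftInvert

namespace Comp

variable {α β : Type}

/-- The underlying law on pairs (result, number of steps). -/
def law (m : Comp α) : PMF (α × ℕ) := m

/-- The expectation of a nonnegative function of the result. -/
def expect (m : Comp α) (φ : α → ℝ≥0∞) : ℝ≥0∞ := ∑' r, m.law r * φ r.1

theorem tsum_bind_mul {α β : Type} (p : PMF α) (f : α → PMF β) (ψ : β → ℝ≥0∞) :
    ∑' b, (p.bind f) b * ψ b = ∑' a, p a * ∑' b, f a b * ψ b := by
  simp_rw [PMF.bind_apply, ← ENNReal.tsum_mul_right, ← ENNReal.tsum_mul_left]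
  rw [ENNReal.tsum_comm]
  simp_rw [mul_assoc]

theorem tsum_pure_mul {α : Type} (a : α) (ψ : α → ℝ≥0∞) :
    ∑' b, (PMF.pure a) b * ψ b = ψ a := by
  rw [tsum_eq_single a (fun b hb => by simp [PMF.pure_apply, hb])]
  simp

theorem tsum_map_mul {α β : Type} (p : PMF α) (f : α → β) (ψ : β → ℝ≥0∞) :
    ∑' b, (p.map f) b * ψ b = ∑' a, p a * ψ (f a) := by
  rw [PMF.map, tsum_bind_mul]
  simp_rw [Function.comp, tsum_pure_mul]

@[simp] theorem expect_pure (a : α) (φ : α → ℝ≥0∞) : expect (pure a) φ = φ a :=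
  tsum_pure_mul (a, 0) fun r => φ r.1

@[simp] theorem expect_paid (c : ℕ) (a : α) (φ : α → ℝ≥0∞) : expect (paid c a) φ = φ a :=
  tsum_pure_mul (a, c) fun r => φ r.1

theorem expect_draw (p : PMF α) (φ : α → ℝ≥0∞) : expect (draw p) φ = ∑' a, p a * φ a :=
  tsum_map_mul p (fun a => (a, 1)) fun r => φ r.1

@[simp] theorem expect_bind (m : Comp α) (f : α → Comp β) (φ : β → ℝ≥0∞) :
    expect (m >>= f) φ = expect m fun a => expect (f a) φ := by
  refine (tsum_bind_mul m.law (fun r => PMF.map (fun s => (s.1, r.2 + s.2)) (f r.1).law)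
    fun r => φ r.1).trans ?_
  refine tsum_congr fun r => ?_
  rw [tsum_map_mul (f r.1).law (fun s => (s.1, r.2 + s.2)) fun r => φ r.1]
  rfl

theorem expect_mono (m : Comp α) {φ ψ : α → ℝ≥0∞} (h : ∀ a, φ a ≤ ψ a) :
    expect m φ ≤ expect m ψ :=
  ENNReal.tsum_le_tsum fun r => mul_le_mul_right (h r.1) _

theorem expect_add (m : Comp α) (φ ψ : α → ℝ≥0∞) :
    expect m (fun a => φ a + ψ a) = expect m φ + expect m ψ := by
  simp_rw [expect, mul_add]
  exact ENNReal.tsum_add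

theorem expect_const_mul (m : Comp α) (c : ℝ≥0∞) (φ : α → ℝ≥0∞) :
    expect m (fun a => c * φ a) = c * expect m φ := by
  simp_rw [expect, ← ENNReal.tsum_mul_left]
  exact tsum_congr fun r => mul_left_comm _ _ _

@[simp] theorem expect_const (m : Comp α) (c : ℝ≥0∞) : expect m (fun _ => c) = c := by
  simp_rw [expect, ENNReal.tsum_mul_right, PMF.tsum_coe, one_mul]

theorem expect_sum {ι : Type} (s : Finset ι) (m : Comp α) (φ : ι → α → ℝ≥0∞) :
    expect m (fun a => ∑ i ∈ s, φ i a) = ∑ i ∈ s, expect m (φ i) := by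
  classical
  induction s using Finset.induction_on with
  | empty => simp
  | insert i s hi ih => simp only [Finset.sum_insert hi, expect_add, ih]

@[simp] theorem expect_loop_zero (f : α → Comp α) (a : α) (φ : α → ℝ≥0∞) :
    expect (loop f 0 a) φ = φ a := by
  rw [loop, expect_pure]

@[simp] theorem expect_loop_succ (f : α → Comp α) (k : ℕ) (a : α) (φ : α → ℝ≥0∞) :
    expect (loop f (k + 1) a) φ = expect (f a) fun b => expect (loop f k b) φ := by
  simp [loop]

/-- If one round multiplies the expectation of `φ` by at most `c`, then `k` rounds multiply it by
at most `c ^ k`. -/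
theorem expect_loop_le {f : α → Comp α} {φ : α → ℝ≥0∞} {c : ℝ≥0∞}
    (h : ∀ a, expect (f a) φ ≤ c * φ a) (k : ℕ) (a : α) :
    expect (loop f k a) φ ≤ c ^ k * φ a := by
  induction k generalizing a with
  | zero => simp
  | succ k ih =>
    rw [expect_loop_succ]
    calc _ ≤ expect (f a) fun b => c ^ k * φ b := expect_mono _ ih
      _ = c ^ k * expect (f a) φ := expect_const_mul _ _ _
      _ ≤ c ^ k * (c * φ a) := by gcongr; exact h a
      _ = c ^ (k + 1) * φ a := by ring

/-- The probability that the result is not in `S`. -/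
def failProb (m : Comp α) (S : Set α) : ℝ≥0∞ := expect m (Sᶜ.indicator 1)

theorem prob_eq_expect (m : Comp α) (S : Set α) : m.prob S = expect m (S.indicator 1) := by
  refine (PMF.toOuterMeasure_apply m.law _).trans ?_
  rw [expect]
  refine tsum_congr fun r => ?_
  by_cases h : r.1 ∈ S
  · rw [Set.indicator_of_mem (by exact h), Set.indicator_of_mem h, Pi.one_apply, mul_one]
  · rw [Set.indicator_of_notMem (by exact h), Set.indicator_of_notMem h, mul_zero]

theorem one_sub_failProb_le (m : Comp α) (S : Set α) : 1 - m.failProb S ≤ m.prob S := by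
  rw [tsub_le_iff_right, prob_eq_expect, failProb, ← expect_add]
  rw [← expect_const m 1]
  refine expect_mono _ fun a => ?_
  by_cases h : a ∈ S <;> simp [h]

theorem failProb_le_one (m : Comp α) (S : Set α) : m.failProb S ≤ 1 := by
  rw [← expect_const m 1]
  exact expect_mono _ fun a => Set.indicator_le_self' (fun _ _ => zero_le) a

/-- Markov's inequality. -/
theorem mul_failProb_le (m : Comp α) {S : Set α} {φ : α → ℝ≥0∞} {t : ℝ≥0∞}
    (h : ∀ a ∉ S, t ≤ φ a) : t * m.failProb S ≤ expect m φ := by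
  rw [failProb, ← expect_const_mul]
  refine expect_mono _ fun a => ?_
  by_cases ha : a ∈ S
  · simp [ha]
  · simpa [ha] using h a ha

theorem failProb_bind_le (m : Comp α) (f : α → Comp β) {S : Set α} {T : Set β} {δ ε : ℝ≥0∞}
    (hm : m.failProb S ≤ δ) (hf : ∀ a ∈ S, (f a).failProb T ≤ ε) :
    (m >>= f).failProb T ≤ δ + ε := by
  rw [failProb, expect_bind]
  calc _ ≤ expect m (fun a => Sᶜ.indicator 1 a + ε) := by
        refine expect_mono _ fun a => ?_
        by_cases ha : a ∈ S
        · simpa [ha, failProb] using hf a ha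
        · simp only [Set.mem_compl_iff, ha, not_false_eq_true, Set.indicator_of_mem, Pi.one_apply]
          exact (failProb_le_one _ _).trans le_self_add
    _ ≤ δ + ε := by
        rw [expect_add, expect_const]
        gcongr
        exact hm

/-- Union bound for a loop with a sequence of loop invariants. -/
theorem failProb_loop_le {f : α → Comp α} {S : ℕ → Set α} {δ : ℝ≥0∞}
    (h : ∀ k, ∀ a ∈ S k, (f a).failProb (S (k + 1)) ≤ δ) (k j : ℕ) {a : α} (ha : a ∈ S j) :
    (loop f k a).failProb (S (j + k)) ≤ k * δ := by
  induction k generalizing a j with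
  | zero => simp [loop, failProb, ha]
  | succ k ih =>
    have : (f a >>= fun b => loop f k b).failProb (S (j + (k + 1))) ≤ δ + k * δ :=
      failProb_bind_le _ _ (h j a ha) fun b hb => by
        have := ih (j + 1) hb
        rwa [show j + 1 + k = j + (k + 1) by ring] at this
    calc _ = (f a >>= fun b => loop f k b).failProb (S (j + (k + 1))) := by
          simp [failProb]
      _ ≤ _ := this
      _ = _ := by push_cast; ring

/-! #### Step counts -/

/-- Every outcome takes at most `c` steps. -/
def CostLE (m : Comp α) (c : ℝ) : Prop := ∀ r ∈ m.outcomes, (r.2 : ℝ) ≤ c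

theorem CostLE.mono {m : Comp α} {c c' : ℝ} (h : m.CostLE c) (hc : c ≤ c') : m.CostLE c' :=
  fun r hr => (h r hr).trans hc

theorem costLE_pure (a : α) : CostLE (pure a) 0 := by
  intro r hr
  have : r = (a, 0) := by
    change r ∈ (PMF.pure (a, 0)).support at hr
    simpa using hr
  simp [this]

theorem costLE_paid (c : ℕ) (a : α) : CostLE (paid c a) c := by
  intro r hr
  have : r = (a, c) := by
    change r ∈ (PMF.pure (a, c)).support at hr
    simpa using hr
  simp [this]

theorem costLE_draw (p : PMF α) : CostLE (draw p) 1 := by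
  intro r hr
  change r ∈ (PMF.map (fun a => (a, 1)) p).support at hr
  rw [PMF.mem_support_map_iff] at hr
  obtain ⟨a, -, rfl⟩ := hr
  simp

theorem CostLE.bind {m : Comp α} {f : α → Comp β} {c c' : ℝ} (hm : m.CostLE c)
    (hf : ∀ a, (f a).CostLE c') : (m >>= f).CostLE (c + c') := by
  intro r hr
  change r ∈ (PMF.bind m.law fun r => PMF.map (fun s => (s.1, r.2 + s.2)) (f r.1).law).support at hr
  rw [PMF.mem_support_bind_iff] at hr
  obtain ⟨s, hs, hr⟩ := hr
  rw [PMF.mem_support_map_iff] at hr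
  obtain ⟨q, hq, rfl⟩ := hr
  push_cast
  exact add_le_add (hm s hs) (hf s.1 q hq)

theorem CostLE.loop {f : α → Comp α} {c : ℝ} (hf : ∀ a, (f a).CostLE c) (k : ℕ) (a : α) :
    (loop f k a).CostLE (k * (c + 1)) := by
  induction k generalizing a with
  | zero => simpa [Comp.loop] using costLE_pure a
  | succ k ih =>
    rw [Comp.loop]
    refine CostLE.mono ((hf a).bind fun b => (costLE_paid 1 b).bind ih) ?_
    push_cast
    exact le_of_eq (by ring)

end Comp

section Energy

variable {E : Type*} [NormedAddCommGroup E] [InnerProductSpace ℝ E]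

/-- The quadratic form `⟨x, B x⟩`. -/
def energy (B : E →ₗ[ℝ] E) (x : E) : ℝ := inner ℝ x (B x)

variable {B : E →ₗ[ℝ] E}

theorem energy_smul (c : ℝ) (x : E) : energy B (c • x) = c ^ 2 * energy B x := by
  simp only [energy, map_smul, real_inner_smul_left, real_inner_smul_right]; ring

theorem energy_neg (x : E) : energy B (-x) = energy B x := by
  simp [energy]

theorem energy_add (hB : B.IsSymmetric) (x y : E) :
    energy B (x + y) = energy B x + 2 * inner ℝ x (B y) + energy B y := by
  have : inner ℝ y (B x) = inner ℝ x (B y) := by rw [← hB, real_inner_comm]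
  simp only [energy, map_add, inner_add_left, inner_add_right, this]; ring

theorem energy_sub (hB : B.IsSymmetric) (x y : E) :
    energy B (x - y) = energy B x - 2 * inner ℝ x (B y) + energy B y := by
  rw [sub_eq_add_neg, energy_add hB, energy_neg, map_neg, inner_neg_right]; ring

/-- Young's inequality for a positive semidefinite form. -/
theorem energy_add_le (hB : B.IsSymmetric) (hpos : ∀ x, 0 ≤ energy B x) {t : ℝ} (ht : 0 < t)
    (x y : E) : energy B (x + y) ≤ (1 + t) * energy B x + (1 + 1 / t) * energy B y := by
  have h := hpos (t • x - y)
  rw [energy_sub hB, energy_smul, real_inner_smul_left] at h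
  rw [energy_add hB]
  have h' : 0 ≤ (1 / t) * (t ^ 2 * energy B x - 2 * (t * inner ℝ x (B y)) + energy B y) :=
    mul_nonneg (by positivity) h
  have e : (1 / t) * (t ^ 2 * energy B x - 2 * (t * inner ℝ x (B y)) + energy B y)
      = t * energy B x - 2 * inner ℝ x (B y) + 1 / t * energy B y := by
    field_simp
  linarith

theorem norm_add_sq_le {t : ℝ} (ht : 0 < t) (x y : E) :
    ‖x + y‖ ^ 2 ≤ (1 + t) * ‖x‖ ^ 2 + (1 + 1 / t) * ‖y‖ ^ 2 := by
  have := energy_add_le (B := LinearMap.id) (fun x y => rfl)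
    (fun x => by simp [energy]) ht x y
  simpa [energy] using this

theorem energy_combo_le (hB : B.IsSymmetric) (hpos : ∀ x, 0 ≤ energy B x) {s t : ℝ}
    (hs : 0 ≤ s) (ht : 0 ≤ t) (hst : s + t = 1) (x y : E) :
    energy B (s • x + t • y) ≤ s * energy B x + t * energy B y := by
  have h := mul_nonneg (mul_nonneg hs ht) (hpos (x - y))
  rw [energy_sub hB] at h
  rw [energy_add hB, energy_smul, energy_smul, map_smul, real_inner_smul_left,
    real_inner_smul_right]
  obtain rfl : s = 1 - t := by linarith
  nlinarith

theorem norm_combo_sq_le {s t : ℝ} (hs : 0 ≤ s) (ht : 0 ≤ t) (hst : s + t = 1) (x y : E) :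
    ‖s • x + t • y‖ ^ 2 ≤ s * ‖x‖ ^ 2 + t * ‖y‖ ^ 2 := by
  have := energy_combo_le (B := LinearMap.id) (fun x y => rfl)
    (fun x => by simp [energy]) hs ht hst x y
  simpa [energy] using this

/-- The regularized operator `B + γ`. -/
def shiftBy (B : E →ₗ[ℝ] E) (γ : ℝ) : E →ₗ[ℝ] E := B + γ • LinearMap.id

theorem shiftBy_apply (γ : ℝ) (x : E) : shiftBy B γ x = B x + γ • x := rfl

theorem energy_shiftBy (γ : ℝ) (x : E) : energy (shiftBy B γ) x = energy B x + γ * ‖x‖ ^ 2 := by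
  simp [energy, shiftBy_apply, inner_add_right, real_inner_smul_right]

theorem exists_preimage_of_energy_ge [FiniteDimensional ℝ E] {σ : ℝ} (hσ : 0 < σ)
    (h : ∀ x, σ * ‖x‖ ^ 2 ≤ energy B x) (b : E) : ∃ z, B z = b := by
  refine LinearMap.injective_iff_surjective.1 ?_ b
  rw [injective_iff_map_eq_zero]
  intro x hx
  have := h x
  rw [energy, hx, inner_zero_right] at this
  have : ‖x‖ ^ 2 ≤ 0 := by nlinarith
  simpa using this

/-! #### The accelerated proximal point step -/

/-- The potential of the accelerated method at the pair `(x, v)`, centred at the solution. -/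
def accelPotential (B : E →ₗ[ℝ] E) (m τ : ℝ) (x v : E) : ℝ :=
  energy B x + m * ‖v‖ ^ 2 + τ * energy B v

/-- One step of the accelerated method with exact proximal steps. -/
theorem accel_exact_step (hB : B.IsSymmetric) {σ γ m α : ℝ} (hσ : 0 < σ) (hγ : 0 < γ)
    (hlow : ∀ x, σ * ‖x‖ ^ 2 ≤ energy B x) (hm : m * (σ + γ) = σ * γ) (hα0 : 0 < α) (hα1 : α ≤ 1)
    (hαm : α ^ 2 * γ = m) {x v y x' g v' : E} (hy : (1 + α) • y = x + α • v)
    (hg : g = γ • (y - x')) (hx' : g = B x')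
    (hv' : v' = (1 - α) • v + α • (y - (1 / m) • g)) :
    energy B x' + m * ‖v'‖ ^ 2 ≤ (1 - α) * (energy B x + m * ‖v‖ ^ 2) := by
  have hm0 : 0 < m := by rw [← hαm]; positivity
  have hyx' : y = x' + (1 / γ) • g := by
    rw [hg, smul_smul, one_div_mul_cancel hγ.ne', one_smul]; abel
  -- strong convexity along `y`
  have key : ∀ z, energy B x' + 2 * inner ℝ g (z - y) + (1 / γ) * ‖g‖ ^ 2 + m * ‖z - y‖ ^ 2
      ≤ energy B z := by
    intro z
    have h1 := hlow (z - x')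
    rw [energy_sub hB, ← hx'] at h1
    have h2 : inner ℝ z g = inner ℝ g (z - y) + energy B x' + (1 / γ) * ‖g‖ ^ 2 := by
      have hz : z = (z - y) + (x' + (1 / γ) • g) := by rw [← hyx']; abel
      calc inner ℝ z g = inner ℝ ((z - y) + (x' + (1 / γ) • g)) g := by rw [← hz]
        _ = _ := by
          rw [inner_add_left, inner_add_left, real_inner_smul_left, real_inner_self_eq_norm_sq,
            real_inner_comm, energy, ← hx']
          ring
    have h3 : m * ‖z - y‖ ^ 2 ≤ σ * ‖z - x'‖ ^ 2 + (1 / γ) * ‖g‖ ^ 2 := by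
      have hz : z - y = (z - x') + (-(1 / γ)) • g := by rw [hyx', neg_smul]; abel
      have ht : 0 < σ / γ := by positivity
      have h4 := norm_add_sq_le ht (z - x') ((-(1 / γ)) • g)
      rw [← hz, norm_smul, mul_pow, Real.norm_eq_abs, sq_abs] at h4
      have hmσ : m = σ * γ / (σ + γ) := by field_simp; linarith
      calc m * ‖z - y‖ ^ 2 ≤ m * _ := mul_le_mul_of_nonneg_left h4 hm0.le
        _ = σ * ‖z - x'‖ ^ 2 + (1 / γ) * ‖g‖ ^ 2 := by rw [hmσ]; field_simp; ring
    linarith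
  have k1 := key x
  have k0 := key 0
  have e0 : energy B (0 : E) = 0 := by simp [energy]
  rw [e0, zero_sub, norm_neg, inner_neg_right] at k0
  have hq : ‖v'‖ ^ 2 ≤ ((1 - α) * ‖v‖ ^ 2 + α * ‖y‖ ^ 2)
      - 2 * (α / m) * inner ℝ g ((1 - α) • v + α • y) + (α / m) ^ 2 * ‖g‖ ^ 2 := by
    have hv2 : v' = ((1 - α) • v + α • y) - (α / m) • g := by
      rw [hv', smul_sub, smul_smul, mul_one_div]; abel
    have := norm_combo_sq_le (sub_nonneg.2 hα1) hα0.le (by ring) v y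
    rw [hv2, @norm_sub_sq ℝ, norm_smul, mul_pow, Real.norm_eq_abs, sq_abs]
    simp only [RCLike.re_to_real, real_inner_smul_right]
    rw [real_inner_comm]
    linarith
  have hq' := mul_le_mul_of_nonneg_left hq hm0.le
  have hcoef : m * ((α / m) ^ 2 * ‖g‖ ^ 2) = (1 / γ) * ‖g‖ ^ 2 := by
    rw [← hαm]; field_simp
  have hcoef2 : m * (2 * (α / m) * inner ℝ g ((1 - α) • v + α • y))
      = 2 * α * inner ℝ g ((1 - α) • v + α • y) := by field_simp
  have hx : x = (1 + α) • y - α • v := by rw [hy]; abel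
  have hin : (1 - α) * inner ℝ g (x - y) - α * inner ℝ g y
      + α * inner ℝ g ((1 - α) • v + α • y) = 0 := by
    rw [hx]
    simp only [inner_sub_right, inner_add_right, real_inner_smul_right]
    ring
  have k1' := mul_le_mul_of_nonneg_left k1 (sub_nonneg.2 hα1)
  have k0' := mul_le_mul_of_nonneg_left k0 hα0.le
  have hn : 0 ≤ (1 - α) * (m * ‖x - y‖ ^ 2) :=
    mul_nonneg (sub_nonneg.2 hα1) (by positivity)
  nlinarith

/-- The momentum iterate is an extrapolation of two consecutive iterates. -/
theorem accel_momentum {γ m α : ℝ} (hγ : 0 < γ) (hα0 : 0 < α) (hαm : α ^ 2 * γ = m)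
    {x v y x' v' : E} (hy : (1 + α) • y = x + α • v)
    (hv' : v' = (1 - α) • v + α • (y - (1 / m) • (γ • (y - x')))) :
    v' = (1 / α) • (x' - (1 - α) • x) := by
  have hx : x = (1 + α) • y - α • v := by rw [hy]; abel
  rw [hv', hx, ← hαm, smul_smul]
  have : 1 / (α ^ 2 * γ) * γ = 1 / α ^ 2 := by field_simp
  rw [this]
  match_scalars
  all_goals field_simp
  all_goals ring

theorem accelPotential_add_le (hB : B.IsSymmetric) (hpos : ∀ x, 0 ≤ energy B x) {m τ t : ℝ}
    (hm : 0 ≤ m) (hτ : 0 ≤ τ) (ht : 0 < t) (x v p q : E) :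
    accelPotential B m τ (x + p) (v + q)
      ≤ (1 + t) * accelPotential B m τ x v + (1 + 1 / t) * accelPotential B m τ p q := by
  have h1 := energy_add_le hB hpos ht x p
  have h2 := mul_le_mul_of_nonneg_left (norm_add_sq_le ht v q) hm
  have h3 := mul_le_mul_of_nonneg_left (energy_add_le hB hpos ht v q) hτ
  simp only [accelPotential]
  linarith

theorem accelPotential_nonneg (hpos : ∀ x, 0 ≤ energy B x) {m τ : ℝ} (hm : 0 ≤ m) (hτ : 0 ≤ τ)
    (x v : E) : 0 ≤ accelPotential B m τ x v := by
  have := hpos x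
  have := mul_nonneg hτ (hpos v)
  have : 0 ≤ m * ‖v‖ ^ 2 := by positivity
  simp only [accelPotential]
  linarith

/-- One step of the accelerated method with an inexact proximal point `x' + e`. -/
theorem accel_inexact_step (hB : B.IsSymmetric) {σ γ m α : ℝ} (hσ : 0 < σ) (hγ : 0 < γ)
    (hlow : ∀ x, σ * ‖x‖ ^ 2 ≤ energy B x) (hm : m * (σ + γ) = σ * γ) (hα0 : 0 < α) (hα1 : α ≤ 1)
    (hαm : α ^ 2 * γ = m) {x v y x' z : E} (hy : (1 + α) • y = x + α • v)
    (hx' : γ • (y - x') = B x') :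
    accelPotential B m (α ^ 3 / 8) z ((1 - α) • v + α • (y - (1 / m) • (γ • (y - z))))
      ≤ (1 - α / 4) * accelPotential B m (α ^ 3 / 8) x v
        + 10 / α * energy (shiftBy B γ) (z - x') := by
  have hpos : ∀ x, 0 ≤ energy B x := fun x => le_trans (by positivity) (hlow x)
  have hm0 : 0 < m := by rw [← hαm]; positivity
  set v' := (1 - α) • v + α • (y - (1 / m) • (γ • (y - x'))) with hv'
  set e := z - x' with he
  have hz : z = x' + e := by rw [he]; abel
  have hv : (1 - α) • v + α • (y - (1 / m) • (γ • (y - z))) = v' + (1 / α) • e := by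
    rw [hv', he, smul_smul, smul_smul]
    have : 1 / m * γ = 1 / α ^ 2 := by rw [← hαm]; field_simp
    rw [this]
    match_scalars
    all_goals field_simp
    ring
  have hexact := accel_exact_step hB hσ hγ hlow hm hα0 hα1 hαm hy rfl hx' hv'
  have hmom := accel_momentum hγ hα0 hαm hy hv'
  have hv'en : energy B v' ≤ 2 / α ^ 2 * (energy B x' + energy B x) := by
    rw [hmom, energy_smul, sub_eq_add_neg, ← neg_smul]
    have h1 := energy_add_le hB hpos one_pos x' ((-(1 - α)) • x)
    rw [energy_smul] at h1
    have h2 : (-(1 - α)) ^ 2 * energy B x ≤ energy B x :=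
      mul_le_of_le_one_left (hpos x) (by nlinarith)
    have h3 : energy B (x' + (-(1 - α)) • x) ≤ 2 * (energy B x' + energy B x) := by linarith
    calc _ ≤ (1 / α) ^ 2 * (2 * (energy B x' + energy B x)) := by gcongr
      _ = _ := by ring
  set Φ := energy B x + m * ‖v‖ ^ 2 with hΦ
  have hmv : 0 ≤ m * ‖v‖ ^ 2 := by positivity
  have hmv' : 0 ≤ m * ‖v'‖ ^ 2 := by positivity
  have hΦ0 : 0 ≤ Φ := add_nonneg (hpos x) hmv
  have hPot : accelPotential B m (α ^ 3 / 8) x' v'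
      ≤ (1 - α / 2) * accelPotential B m (α ^ 3 / 8) x v := by
    have h1 : energy B x' + energy B x ≤ 2 * Φ := by nlinarith
    have h2 : α ^ 3 / 8 * energy B v' ≤ α / 2 * Φ :=
      calc α ^ 3 / 8 * energy B v' ≤ α ^ 3 / 8 * (2 / α ^ 2 * (energy B x' + energy B x)) := by
            gcongr
        _ ≤ α ^ 3 / 8 * (2 / α ^ 2 * (2 * Φ)) := by gcongr
        _ = α / 2 * Φ := by field_simp; ring
    have h3 : 0 ≤ (1 - α / 2) * (α ^ 3 / 8 * energy B v) :=
      mul_nonneg (by linarith) (mul_nonneg (by positivity) (hpos v))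
    simp only [accelPotential]
    rw [← hΦ]
    nlinarith
  have hPe : accelPotential B m (α ^ 3 / 8) e ((1 / α) • e)
      ≤ 2 * energy (shiftBy B γ) e := by
    have h1 : m * ‖(1 / α) • e‖ ^ 2 = γ * ‖e‖ ^ 2 := by
      rw [norm_smul, mul_pow, Real.norm_eq_abs, sq_abs, ← hαm]; field_simp
    have h2 : α ^ 3 / 8 * energy B ((1 / α) • e) = α / 8 * energy B e := by
      rw [energy_smul]; field_simp
    have h3 : α / 8 * energy B e ≤ 1 * energy B e :=
      mul_le_mul_of_nonneg_right (by linarith) (hpos e)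
    have h4 : 0 ≤ γ * ‖e‖ ^ 2 := by positivity
    rw [energy_shiftBy, accelPotential, h1, h2]
    linarith
  have hα4 : 0 < α / 4 := by positivity
  have hyoung := accelPotential_add_le hB hpos hm0.le (by positivity : 0 ≤ α ^ 3 / 8) hα4
    x' v' e ((1 / α) • e)
  rw [hv, hz]
  refine hyoung.trans (add_le_add ?_ ?_)
  · have hP := accelPotential_nonneg hpos hm0.le (by positivity : 0 ≤ α ^ 3 / 8) x v
    calc _ ≤ (1 + α / 4) * ((1 - α / 2) * accelPotential B m (α ^ 3 / 8) x v) := by gcongr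
      _ = ((1 + α / 4) * (1 - α / 2)) * accelPotential B m (α ^ 3 / 8) x v := by ring
      _ ≤ _ := by gcongr; nlinarith
  · have hH : 0 ≤ energy (shiftBy B γ) e := by
      rw [energy_shiftBy]; exact add_nonneg (hpos e) (by positivity)
    have h5 : 1 + 1 / (α / 4) ≤ 5 / α := by
      rw [one_div_div, ← sub_nonneg]
      have : 5 / α - (1 + 4 / α) = (1 - α) / α := by field_simp; ring
      rw [this]
      exact div_nonneg (by linarith) hα0.le
    calc _ ≤ 5 / α * (2 * energy (shiftBy B γ) e) :=
          mul_le_mul h5 hPe (accelPotential_nonneg hpos hm0.le (by positivity) _ _) (by positivity)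
      _ = _ := by ring

/-- The energy of the exact proximal displacement is at most that of the centre. -/
theorem energy_prox_displacement_le (hB : B.IsSymmetric) (hpos : ∀ x, 0 ≤ energy B x) {γ : ℝ}
    (hγ : 0 < γ) {y x' : E} (hx' : γ • (y - x') = B x') :
    energy (shiftBy B γ) (y - x') ≤ energy B y := by
  have h1 : shiftBy B γ (y - x') = B y := by
    rw [shiftBy_apply, map_sub, hx']; abel
  have hy : y = x' + (1 / γ) • B x' := by
    rw [← hx', smul_smul, one_div_mul_cancel hγ.ne', one_smul]; abel
  have h2 : 0 ≤ inner ℝ x' (B y) := by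
    rw [← hB]
    nth_rewrite 1 [hy]
    rw [inner_add_right, real_inner_smul_right, real_inner_self_eq_norm_sq, real_inner_comm]
    exact add_nonneg (hpos x') (by positivity)
  rw [energy, h1, inner_sub_left]
  simp only [energy]
  linarith

theorem energy_extrapolation_le (hB : B.IsSymmetric) (hpos : ∀ x, 0 ≤ energy B x) {m α : ℝ}
    (hm : 0 ≤ m) (hα0 : 0 < α) (hα1 : α ≤ 1) (x v : E) :
    energy B ((1 / (1 + α)) • x + (α / (1 + α)) • v)
      ≤ 8 / α ^ 3 * accelPotential B m (α ^ 3 / 8) x v := by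
  have h1 : 1 / (1 + α) ≤ 1 := by rw [div_le_one (by positivity)]; linarith
  have h2 : α / (1 + α) ≤ 1 := by rw [div_le_one (by positivity)]; linarith
  have h := energy_combo_le hB hpos (by positivity : 0 ≤ 1 / (1 + α))
    (by positivity : 0 ≤ α / (1 + α)) (by field_simp) x v
  have h3 := mul_le_mul_of_nonneg_right h1 (hpos x)
  have h4 := mul_le_mul_of_nonneg_right h2 (hpos v)
  have h5 : 8 / α ^ 3 * accelPotential B m (α ^ 3 / 8) x v
      = 8 / α ^ 3 * energy B x + 8 / α ^ 3 * (m * ‖v‖ ^ 2) + energy B v := by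
    rw [accelPotential]; field_simp
  have h6 : 1 ≤ 8 / α ^ 3 := by
    rw [one_le_div (by positivity)]
    have : α ^ 3 ≤ 1 := pow_le_one₀ hα0.le hα1
    linarith
  have h7 := mul_le_mul_of_nonneg_right h6 (hpos x)
  have h8 : 0 ≤ 8 / α ^ 3 * (m * ‖v‖ ^ 2) := by positivity
  linarith

end Energy

section Power

variable {E : Type*} [NormedAddCommGroup E] [InnerProductSpace ℝ E] {B : E →ₗ[ℝ] E}

/-- The component of `x` orthogonal to the unit vector `v`. -/
def perp (v x : E) : E := x - (inner ℝ v x : ℝ) • v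

theorem perp_smul (v : E) (c : ℝ) (x : E) : perp v (c • x) = c • perp v x := by
  rw [perp, perp, real_inner_smul_right, smul_sub, smul_smul]

theorem perp_add (v x y : E) : perp v (x + y) = perp v x + perp v y := by
  rw [perp, perp, perp, inner_add_right, add_smul]; abel

theorem inner_perp {v : E} (hv : ‖v‖ = 1) (x : E) : (inner ℝ v (perp v x) : ℝ) = 0 := by
  rw [perp, inner_sub_right, real_inner_smul_right, real_inner_self_eq_norm_sq, hv]; ring

theorem norm_sq_eq_add_perp {v : E} (hv : ‖v‖ = 1) (x : E) :
    ‖x‖ ^ 2 = (inner ℝ v x : ℝ) ^ 2 + ‖perp v x‖ ^ 2 := by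
  have hx : x = (inner ℝ v x : ℝ) • v + perp v x := by rw [perp]; abel
  conv_lhs => rw [hx]
  rw [@norm_add_sq ℝ, norm_smul, hv, RCLike.re_to_real, real_inner_smul_left, inner_perp hv,
    mul_one, Real.norm_eq_abs, sq_abs]
  ring

/-- `v` is a unit eigenvector of the symmetric operator `B` for its lowest eigenvalue `b₁ > 0`, and
all other eigenvalues are at least `100 b₁`. -/
structure LowMode (B : E →ₗ[ℝ] E) (v : E) (b₁ : ℝ) : Prop where
  symm : B.IsSymmetric
  norm_eq : ‖v‖ = 1
  eigen : B v = b₁ • v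
  pos : 0 < b₁
  gap : ∀ w, (inner ℝ v w : ℝ) = 0 → 100 * b₁ * ‖w‖ ^ 2 ≤ energy B w

namespace LowMode

variable {v : E} {b₁ : ℝ} (h : LowMode B v b₁)
include h

theorem map_perp (x : E) : B (perp v x) = perp v (B x) := by
  have h1 : (inner ℝ v (B x) : ℝ) = b₁ * inner ℝ v x := by
    rw [← h.symm, h.eigen, real_inner_smul_left]
  rw [perp, perp, map_sub, map_smul, h.eigen, h1, smul_smul, mul_comm]

theorem energy_eq (x : E) :
    energy B x = b₁ * (inner ℝ v x : ℝ) ^ 2 + energy B (perp v x) := by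
  have hx : x = (inner ℝ v x : ℝ) • v + perp v x := by rw [perp]; abel
  have h0 : (inner ℝ v (B (perp v x)) : ℝ) = 0 := by rw [h.map_perp, inner_perp h.norm_eq]
  have hv : energy B v = b₁ := by
    rw [energy, h.eigen, real_inner_smul_right, real_inner_self_eq_norm_sq, h.norm_eq]; ring
  conv_lhs => rw [hx]
  rw [energy_add h.symm, energy_smul, real_inner_smul_left, h0, hv]
  ring

theorem norm_perp_le (x : E) : 100 * b₁ * ‖perp v x‖ ^ 2 ≤ energy B (perp v x) :=
  h.gap _ (inner_perp h.norm_eq x)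

theorem energy_perp_nonneg (x : E) : 0 ≤ energy B (perp v x) := by
  have := h.norm_perp_le x
  have := h.pos
  exact le_trans (by positivity) (h.norm_perp_le x)

theorem le_energy (x : E) : b₁ * ‖x‖ ^ 2 ≤ energy B x := by
  rw [h.energy_eq, norm_sq_eq_add_perp h.norm_eq]
  have := h.norm_perp_le x
  have : 0 ≤ b₁ * ‖perp v x‖ ^ 2 := mul_nonneg h.pos.le (sq_nonneg _)
  nlinarith

theorem energy_nonneg (x : E) : 0 ≤ energy B x :=
  le_trans (mul_nonneg h.pos.le (sq_nonneg _)) (h.le_energy x)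

theorem energy_perp_le (x : E) : energy B (perp v x) ≤ energy B x := by
  rw [h.energy_eq x]
  have : 0 ≤ b₁ * (inner ℝ v x : ℝ) ^ 2 := mul_nonneg h.pos.le (sq_nonneg _)
  linarith

theorem inner_sq_le (x : E) : b₁ * (inner ℝ v x : ℝ) ^ 2 ≤ energy B x := by
  rw [h.energy_eq x]
  linarith [h.energy_perp_nonneg x]

/-- Applying the inverse divides the component along `v` by `b₁`. -/
theorem inner_preimage {x z : E} (hz : B z = x) : (inner ℝ v x : ℝ) = b₁ * inner ℝ v z := by
  rw [← hz, ← h.symm, h.eigen, real_inner_smul_left]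

/-- Applying the inverse divides the energy of the orthogonal component by `(100 b₁)²`. -/
theorem energy_perp_preimage_le {x z : E} (hz : B z = x) :
    (100 * b₁) ^ 2 * energy B (perp v z) ≤ energy B (perp v x) := by
  have hb := h.pos
  set u := perp v z with hu
  have hw : perp v x = B u := by rw [hu, h.map_perp, hz]
  have h1 := h.norm_perp_le z
  rw [← hu] at h1
  have h2 : 100 * b₁ * ‖B u‖ ^ 2 ≤ energy B (B u) := by
    rw [← hw]; exact h.norm_perp_le x
  have h3 : energy B u ≤ ‖u‖ * ‖B u‖ := real_inner_le_norm _ _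
  have h4 : 100 * b₁ * ‖u‖ ≤ ‖B u‖ := by
    rcases eq_or_lt_of_le (norm_nonneg u) with h0 | h0
    · rw [← h0, mul_zero]; exact norm_nonneg _
    · have : 100 * b₁ * ‖u‖ * ‖u‖ ≤ ‖B u‖ * ‖u‖ := by nlinarith
      exact le_of_mul_le_mul_right this h0
  rw [hw]
  calc (100 * b₁) ^ 2 * energy B u ≤ (100 * b₁) ^ 2 * (‖u‖ * ‖B u‖) := by gcongr
    _ = 100 * b₁ * ((100 * b₁ * ‖u‖) * ‖B u‖) := by ring
    _ ≤ 100 * b₁ * (‖B u‖ * ‖B u‖) := by gcongr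
    _ ≤ _ := by rw [← sq]; exact h2

/-- The error of the best multiple of a unit vector `x` as an approximation to `B⁻¹ x`. -/
theorem initial_error_le {x z : E} (hx : ‖x‖ = 1) (hz : B z = x) :
    energy B ((1 / inner ℝ x (B x) : ℝ) • x - z) ≤ energy B (perp v x) / b₁ ^ 2 := by
  have hb := h.pos
  have hbest : energy B ((1 / inner ℝ x (B x) : ℝ) • x - z)
      ≤ energy B ((1 / b₁) • x - z) := by
    have hq : 0 < energy B x := lt_of_lt_of_le (by rw [hx]; positivity) (h.le_energy x)
    change energy B ((1 / energy B x) • x - z) ≤ _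
    rw [energy_sub h.symm, energy_sub h.symm, energy_smul, energy_smul, hz, real_inner_smul_left,
      real_inner_smul_left, real_inner_self_eq_norm_sq, hx]
    have e : (1 / b₁) ^ 2 * energy B x - 2 * (1 / b₁ * 1 ^ 2)
        - ((1 / energy B x) ^ 2 * energy B x - 2 * (1 / energy B x * 1 ^ 2))
        = energy B x * (1 / b₁ - 1 / energy B x) ^ 2 := by
      field_simp; ring
    have : 0 ≤ energy B x * (1 / b₁ - 1 / energy B x) ^ 2 := by positivity
    linarith
  refine hbest.trans ?_
  have hc := h.inner_preimage hz
  have hin : (inner ℝ v ((1 / b₁) • x - z) : ℝ) = 0 := by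
    rw [inner_sub_right, real_inner_smul_right, hc]; field_simp; ring
  rw [h.energy_eq, hin]
  have hp : perp v ((1 / b₁) • x - z) = (1 / b₁) • perp v x - perp v z := by
    rw [sub_eq_add_neg, ← neg_one_smul ℝ z, perp_add, perp_smul, perp_smul]; module
  set u := perp v z with hu
  have hw : perp v x = B u := by rw [hu, h.map_perp, hz]
  rw [hp, energy_sub h.symm, energy_smul, real_inner_smul_left, ← hw, real_inner_self_eq_norm_sq]
  have h3 : energy B u ≤ 1 / b₁ * ‖perp v x‖ ^ 2 := by
    have h1 := h.norm_perp_le z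
    rw [← hu] at h1
    have h2 : energy B u ≤ ‖u‖ * ‖B u‖ := real_inner_le_norm _ _
    rw [← hw] at h2
    have h4 : b₁ * ‖u‖ ≤ ‖perp v x‖ := by
      rcases eq_or_lt_of_le (norm_nonneg u) with h0 | h0
      · rw [← h0, mul_zero]; exact norm_nonneg _
      · have : b₁ * ‖u‖ * ‖u‖ ≤ ‖perp v x‖ * ‖u‖ := by
          have : 0 ≤ b₁ * ‖u‖ ^ 2 := by positivity
          nlinarith
        exact le_of_mul_le_mul_right this h0
    calc energy B u ≤ ‖u‖ * ‖perp v x‖ := h2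
      _ = 1 / b₁ * ((b₁ * ‖u‖) * ‖perp v x‖) := by field_simp
      _ ≤ 1 / b₁ * (‖perp v x‖ * ‖perp v x‖) := by gcongr
      _ = _ := by ring
  have h5 : 0 ≤ 1 / b₁ * ‖perp v x‖ ^ 2 := by positivity
  have h6 : energy B (perp v x) / b₁ ^ 2 = (1 / b₁) ^ 2 * energy B (perp v x) := by ring
  rw [h6]
  linarith

/-- The orthogonal component after an inexact inverse iteration. -/
theorem energy_perp_inexact_le {x z z' : E} (hz : B z' = x) :
    energy B (perp v z) ≤ energy B (perp v x) / (5000 * b₁ ^ 2) + 2 * energy B (z - z') := by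
  have hb := h.pos
  have h1 := energy_add_le h.symm h.energy_nonneg one_pos (perp v z') (perp v (z - z'))
  rw [← perp_add, add_sub_cancel] at h1
  have h2 := h.energy_perp_preimage_le hz
  have h3 := h.energy_perp_le (z - z')
  have h4 : 2 * energy B (perp v z') ≤ energy B (perp v x) / (5000 * b₁ ^ 2) := by
    rw [le_div_iff₀ (by positivity)]
    linarith
  linarith

/-- The component along `v` after an inexact inverse iteration. -/
theorem le_inner_sq_inexact {x z z' : E} {s : ℝ} (hz : B z' = x) (hs0 : 0 ≤ s) (hs1 : s ≤ 1)
    (herr : energy B (z - z') ≤ s ^ 2 * (inner ℝ v x : ℝ) ^ 2 / b₁) :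
    (1 - s) ^ 2 * (inner ℝ v x : ℝ) ^ 2 ≤ b₁ ^ 2 * (inner ℝ v z : ℝ) ^ 2 := by
  have hb := h.pos
  have h1 := (h.inner_sq_le (z - z')).trans herr
  rw [le_div_iff₀ hb, inner_sub_right] at h1
  rw [h.inner_preimage hz] at h1 ⊢
  set a : ℝ := inner ℝ v z
  set c : ℝ := inner ℝ v z'
  have h2 : (b₁ * (a - c)) ^ 2 ≤ (s * (b₁ * c)) ^ 2 := by nlinarith
  have h3 := sq_le_sq.1 h2
  rw [← mul_pow, ← mul_pow, sq_le_sq, abs_mul, abs_of_nonneg (sub_nonneg.2 hs1)]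
  rw [abs_mul s, abs_of_nonneg hs0] at h3
  have h4 : |b₁ * c| ≤ |b₁ * a| + |b₁ * (a - c)| := by
    calc |b₁ * c| = |b₁ * a - b₁ * (a - c)| := by ring_nf
      _ ≤ _ := abs_sub _ _
  linarith

/-- An inexact inverse iteration in the burn-in phase. -/
theorem burnIn_step {x z z' : E} {Q : ℝ} (hz : B z' = x) (hc : (inner ℝ v x : ℝ) ≠ 0)
    (hQ : 0 ≤ Q) (hx : energy B (perp v x) ≤ Q * (b₁ * (inner ℝ v x : ℝ) ^ 2))
    (herr : energy B (z - z') ≤ (1 / 100) ^ 2 * (inner ℝ v x : ℝ) ^ 2 / b₁) :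
    (inner ℝ v z : ℝ) ≠ 0 ∧
      energy B (perp v z) ≤ (Q + 1) / 1000 * (b₁ * (inner ℝ v z : ℝ) ^ 2) := by
  have hb := h.pos
  have h1 := h.le_inner_sq_inexact hz (by norm_num) (by norm_num) herr
  have h2 := h.energy_perp_inexact_le hz (z := z)
  set a : ℝ := inner ℝ v z
  set c : ℝ := inner ℝ v x
  have hc2 : 0 < c ^ 2 := by positivity
  constructor
  · intro ha
    rw [ha] at h1
    nlinarith
  · have h3 : energy B (perp v x) / (5000 * b₁ ^ 2) ≤ Q * c ^ 2 / (5000 * b₁) := by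
      rw [div_le_div_iff₀ (by positivity) (by positivity)]
      calc _ ≤ Q * (b₁ * c ^ 2) * (5000 * b₁) := by gcongr
        _ = _ := by ring
    have h4 : energy B (perp v z) ≤ (Q + 1) * (c ^ 2 / (5000 * b₁)) := by
      calc _ ≤ _ := h2
        _ ≤ Q * c ^ 2 / (5000 * b₁) + 2 * ((1 / 100) ^ 2 * c ^ 2 / b₁) := by gcongr
        _ = _ := by field_simp; ring
    refine h4.trans ?_
    have h5 : c ^ 2 / (5000 * b₁) ≤ 1 / 1000 * (b₁ * a ^ 2) := by
      rw [div_le_iff₀ (by positivity)]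
      nlinarith
    calc _ ≤ (Q + 1) * (1 / 1000 * (b₁ * a ^ 2)) := by gcongr
      _ = _ := by ring

theorem inner_sq_ge_of_warm {x : E} (hx : ‖x‖ = 1) (hw : energy B (perp v x) ≤ 17 / 100 * b₁) :
    998 / 1000 ≤ (inner ℝ v x : ℝ) ^ 2 := by
  have hb := h.pos
  have h1 := norm_sq_eq_add_perp h.norm_eq x
  have h2 := (h.norm_perp_le x).trans hw
  have h3 : ‖perp v x‖ ^ 2 ≤ 17 / 10000 := by
    have : b₁ * ‖perp v x‖ ^ 2 ≤ b₁ * (17 / 10000) := by linarith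
    exact le_of_mul_le_mul_left this hb
  rw [hx] at h1
  linarith

/-- From a warm start an accurate inverse iteration is accepted. -/
theorem warm_accept {x z z' : E} {μ : ℝ} (hz : B z' = x) (hx : ‖x‖ = 1)
    (hw : energy B (perp v x) ≤ 17 / 100 * b₁) (hμ : 10 / 11 * b₁ ≤ μ)
    (herr : energy B (z - z') ≤ 1 / (500 * b₁)) :
    energy B z ≤ 7 / 6 * μ * ‖z‖ ^ 2 ∧ 2 / 3 * (1 / μ) ≤ ‖z‖ := by
  have hb := h.pos
  have hμ0 : 0 < μ := by linarith
  have hc := h.inner_sq_ge_of_warm hx hw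
  have herr' : energy B (z - z') ≤ (1 / 20) ^ 2 * (inner ℝ v x : ℝ) ^ 2 / b₁ := by
    refine herr.trans ?_
    rw [div_le_div_iff₀ (by positivity) hb]
    nlinarith
  have h1 := h.le_inner_sq_inexact hz (by norm_num) (by norm_num) herr'
  have h2 := h.energy_perp_inexact_le hz (z := z)
  have h3 := norm_sq_eq_add_perp h.norm_eq z
  rw [h.energy_eq z]
  set a : ℝ := inner ℝ v z
  set c : ℝ := inner ℝ v x
  have ha : 9 / 10 ≤ b₁ ^ 2 * a ^ 2 := by nlinarith
  have hp : energy B (perp v z) ≤ 1 / 200 / b₁ := by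
    have : energy B (perp v x) / (5000 * b₁ ^ 2) ≤ 1 / 10000 / b₁ := by
      rw [div_le_div_iff₀ (by positivity) hb]
      calc _ ≤ 17 / 100 * b₁ * b₁ := by gcongr
        _ ≤ _ := by nlinarith [sq_nonneg b₁]
    calc _ ≤ _ := h2
      _ ≤ 1 / 10000 / b₁ + 2 * (1 / (500 * b₁)) := by gcongr
      _ = (41 / 10000) * (1 / b₁) := by field_simp; ring
      _ ≤ (1 / 200) * (1 / b₁) := mul_le_mul_of_nonneg_right (by norm_num) (by positivity)
      _ = _ := by ring
  have hp' : 1 / 200 / b₁ ≤ 1 / 100 * (b₁ * a ^ 2) := by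
    rw [div_le_iff₀ hb]; nlinarith
  constructor
  · have h5 : b₁ * a ^ 2 ≤ 11 / 10 * μ * a ^ 2 := by
      have := mul_le_mul_of_nonneg_right hμ (sq_nonneg a)
      linarith
    have h6 : 0 ≤ μ * ‖perp v z‖ ^ 2 := by positivity
    have h7 : 0 ≤ μ * a ^ 2 := by positivity
    rw [h3]
    nlinarith
  · have h4 : 9 / 10 / b₁ ^ 2 ≤ ‖z‖ ^ 2 := by
      rw [div_le_iff₀ (by positivity), h3]
      nlinarith [mul_nonneg (sq_nonneg b₁) (sq_nonneg ‖perp v z‖)]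
    refine le_of_sq_le_sq ?_ (norm_nonneg z)
    refine le_trans ?_ h4
    have h5 : (2 / 3 * (1 / μ)) ≤ 22 / 30 / b₁ := by
      rw [mul_one_div, div_le_div_iff₀ hμ0 hb]; linarith
    calc _ ≤ (22 / 30 / b₁) ^ 2 := by gcongr
      _ = (22 / 30) ^ 2 / b₁ ^ 2 := by rw [div_pow]
      _ ≤ _ := by gcongr; norm_num

/-- A vector with an accepted Rayleigh quotient is warm after normalization. -/
theorem warm_of_energy_le {z : E} {μ : ℝ} (hμ : μ ≤ b₁) (hz : z ≠ 0)
    (hq : energy B z ≤ 7 / 6 * μ * ‖z‖ ^ 2) :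
    energy B (perp v ((1 / ‖z‖) • z)) ≤ 17 / 100 * b₁ := by
  have hb := h.pos
  have hn : 0 < ‖z‖ := norm_pos_iff.2 hz
  have h1 := h.norm_perp_le z
  have h3 := norm_sq_eq_add_perp h.norm_eq z
  rw [h.energy_eq z] at hq
  rw [perp_smul, energy_smul, div_pow, one_pow, one_div, inv_mul_le_iff₀ (by positivity)]
  have h4 : 7 / 6 * μ * ‖z‖ ^ 2 ≤ 7 / 6 * b₁ * ‖z‖ ^ 2 := by gcongr
  have h5 : b₁ * ‖z‖ ^ 2 = b₁ * (inner ℝ v z : ℝ) ^ 2 + b₁ * ‖perp v z‖ ^ 2 := by rw [h3]; ring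
  have h6 : 0 ≤ b₁ * ‖z‖ ^ 2 := by positivity
  nlinarith

end LowMode

end Power

section Spectrum

variable {n d : ℕ} (A : Matrix (Fin n) (Fin d) ℝ)

/-- `x ↦ Aᵀ A x` as a linear map. -/
def gramLin : Vec d →ₗ[ℝ] Vec d where
  toFun := gramMul A
  map_add' x y := by simp [gramMul, Matrix.mulVec_add]
  map_smul' c x := by simp [gramMul, Matrix.mulVec_smul]

theorem gramLin_apply (x : Vec d) : gramLin A x = gramMul A x := rfl

theorem inner_gramMul (x y : Vec d) :
    (inner ℝ x (gramMul A y) : ℝ) = ∑ i, (inner ℝ (row A i) x : ℝ) * inner ℝ (row A i) y := by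
  have h : ∀ (i : Fin n) (z : Vec d), (inner ℝ (row A i) z : ℝ) = (A *ᵥ z.ofLp) i := by
    intro i z
    rw [PiLp.inner_apply]
    simp [row, Matrix.mulVec, dotProduct, mul_comm]
  simp only [h]
  have : (inner ℝ x (gramMul A y) : ℝ) = (Aᵀ *ᵥ (A *ᵥ y.ofLp)) ⬝ᵥ x.ofLp := by
    rw [EuclideanSpace.inner_eq_star_dotProduct]; simp [gramMul]
  rw [this, Matrix.mulVec_transpose, ← Matrix.dotProduct_mulVec, dotProduct]
  exact Finset.sum_congr rfl fun i _ => mul_comm _ _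

theorem energy_gramLin (x : Vec d) :
    energy (gramLin A) x = ∑ i, (inner ℝ (row A i) x : ℝ) ^ 2 := by
  rw [energy, gramLin_apply, inner_gramMul]
  exact Finset.sum_congr rfl fun i _ => (sq _).symm

theorem gramLin_isSymmetric : (gramLin A).IsSymmetric := by
  intro x y
  rw [real_inner_comm, gramLin_apply, gramLin_apply, inner_gramMul, inner_gramMul]
  exact Finset.sum_congr rfl fun i _ => mul_comm _ _

theorem norm_row_sq (i : Fin n) : ‖row A i‖ ^ 2 = rowSq A i := by
  rw [EuclideanSpace.norm_sq_eq]
  simp [row, rowSq]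

theorem rowSq_nonneg (i : Fin n) : 0 ≤ rowSq A i := by
  rw [← norm_row_sq]; positivity

theorem energy_gramLin_nonneg (x : Vec d) : 0 ≤ energy (gramLin A) x := by
  rw [energy_gramLin]; positivity

theorem energy_gramLin_le_frobSq (x : Vec d) :
    energy (gramLin A) x ≤ frobSq A * ‖x‖ ^ 2 := by
  rw [energy_gramLin, frobSq, Finset.sum_mul]
  refine Finset.sum_le_sum fun i _ => ?_
  rw [← norm_row_sq, ← mul_pow]
  exact sq_le_sq.2 (by rw [abs_of_nonneg (by positivity : 0 ≤ ‖row A i‖ * ‖x‖)]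
                       exact abs_real_inner_le_norm _ _)

theorem gramMul_eigenvectorBasis (j : Fin d) :
    gramMul A ((gram_isHermitian A).eigenvectorBasis j)
      = (gram_isHermitian A).eigenvalues j • (gram_isHermitian A).eigenvectorBasis j := by
  have := (gram_isHermitian A).mulVec_eigenvectorBasis j
  rw [gramMul, Matrix.mulVec_mulVec, this]
  simp

theorem energy_gramLin_eq_sum (x : Vec d) :
    energy (gramLin A) x = ∑ j, (gram_isHermitian A).eigenvalues j
      * (inner ℝ ((gram_isHermitian A).eigenvectorBasis j) x : ℝ) ^ 2 := by
  rw [energy, ← OrthonormalBasis.sum_inner_mul_inner (gram_isHermitian A).eigenvectorBasis]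
  refine Finset.sum_congr rfl fun j _ => ?_
  rw [← gramLin_isSymmetric, gramLin_apply, gramMul_eigenvectorBasis, real_inner_smul_left,
    real_inner_comm]
  ring

theorem norm_sq_eq_sum (x : Vec d) :
    ‖x‖ ^ 2 = ∑ j, (inner ℝ ((gram_isHermitian A).eigenvectorBasis j) x : ℝ) ^ 2 := by
  rw [← real_inner_self_eq_norm_sq,
    ← OrthonormalBasis.sum_inner_mul_inner (gram_isHermitian A).eigenvectorBasis]
  refine Finset.sum_congr rfl fun j _ => ?_
  rw [real_inner_comm]
  ring

/-- The position of an index of `eigenvalues` in the decreasing enumeration. -/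
theorem exists_rank : ∃ e : Fin d ≃ Fin d,
    ∀ j, (gram_isHermitian A).eigenvalues j = eig A (e j) := by
  let e₀ : Fin (Fintype.card (Fin d)) ≃ Fin d := Fintype.equivOfCardEq (Fintype.card_fin _)
  refine ⟨e₀.symm.trans (finCongr (Fintype.card_fin d)), fun j => ?_⟩
  have h : ((e₀.symm.trans (finCongr (Fintype.card_fin d)) j : Fin d) : ℕ) < d := Fin.is_lt _
  rw [eig, dif_pos h]
  rfl

theorem eig_antitone {k l : ℕ} (hkl : k ≤ l) (hl : l < d) : eig A l ≤ eig A k := by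
  rw [eig, eig, dif_pos hl, dif_pos (hkl.trans_lt hl)]
  exact (gram_isHermitian A).eigenvalues₀_antitone hkl

theorem eig_nonneg (k : ℕ) : 0 ≤ eig A k := by
  by_cases hk : k < d
  · obtain ⟨e, he⟩ := exists_rank A
    have h := he (e.symm ⟨k, hk⟩)
    rw [Equiv.apply_symm_apply] at h
    rw [show eig A k = _ from h.symm]
    set j := e.symm ⟨k, hk⟩
    have h2 := energy_gramLin_nonneg A ((gram_isHermitian A).eigenvectorBasis j)
    rwa [energy, gramLin_apply, gramMul_eigenvectorBasis, real_inner_smul_right,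
      real_inner_self_eq_norm_sq, OrthonormalBasis.norm_eq_one, one_pow, mul_one] at h2
  · rw [eig, dif_neg hk]

theorem energy_gramLin_le (x : Vec d) : energy (gramLin A) x ≤ eig A 0 * ‖x‖ ^ 2 := by
  obtain ⟨e, he⟩ := exists_rank A
  rw [energy_gramLin_eq_sum, norm_sq_eq_sum A, Finset.mul_sum]
  refine Finset.sum_le_sum fun j _ => mul_le_mul_of_nonneg_right ?_ (sq_nonneg _)
  rw [he]
  exact eig_antitone A (Nat.zero_le _) (e j).is_lt

theorem energy_gramLin_le_of_orthogonal (hgap : eig A 1 < eig A 0) {v x : Vec d} (hv : ‖v‖ = 1)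
    (hev : gramMul A v = eig A 0 • v) (hx : (inner ℝ v x : ℝ) = 0) :
    energy (gramLin A) x ≤ eig A 1 * ‖x‖ ^ 2 := by
  obtain ⟨e, he⟩ := exists_rank A
  set u := (gram_isHermitian A).eigenvectorBasis with hu
  have hle : ∀ j, (e j : ℕ) ≠ 0 → (gram_isHermitian A).eigenvalues j ≤ eig A 1 := fun j hj => by
    rw [he]
    exact eig_antitone A (Nat.one_le_iff_ne_zero.2 hj) (e j).is_lt
  have horth : ∀ j, (e j : ℕ) ≠ 0 → (inner ℝ (u j) v : ℝ) = 0 := fun j hj => by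
    have h1 : (inner ℝ (gramLin A (u j)) v : ℝ) = inner ℝ (u j) (gramLin A v) :=
      gramLin_isSymmetric A _ _
    rw [gramLin_apply, gramLin_apply, hev, hu, gramMul_eigenvectorBasis, real_inner_smul_left,
      real_inner_smul_right] at h1
    have h2 := hle j hj
    have h3 : ((gram_isHermitian A).eigenvalues j - eig A 0) * (inner ℝ (u j) v : ℝ) = 0 := by
      rw [sub_mul, h1, sub_self]
    rcases mul_eq_zero.1 h3 with h4 | h4
    · linarith
    · exact h4
  have hzero : ∀ j, (e j : ℕ) = 0 → (inner ℝ (u j) x : ℝ) = 0 := fun j hj => by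
    have huniq : ∀ i, i ≠ j → (inner ℝ (u i) v : ℝ) = 0 := fun i hi => by
      refine horth i fun h0 => hi (e.injective (Fin.ext (h0.trans hj.symm)))
    have h1 : (inner ℝ v v : ℝ) = (inner ℝ (u j) v : ℝ) ^ 2 := by
      rw [← OrthonormalBasis.sum_inner_mul_inner u,
        Finset.sum_eq_single j (fun i _ hi => by rw [huniq i hi, mul_zero]) (by simp),
        real_inner_comm]
      ring
    have h2 : (inner ℝ v x : ℝ) = (inner ℝ (u j) v : ℝ) * inner ℝ (u j) x := by
      rw [← OrthonormalBasis.sum_inner_mul_inner u,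
        Finset.sum_eq_single j
          (fun i _ hi => by rw [real_inner_comm, huniq i hi, zero_mul]) (by simp),
        real_inner_comm]
    rw [real_inner_self_eq_norm_sq, hv] at h1
    rw [hx] at h2
    rcases mul_eq_zero.1 h2.symm with h3 | h3
    · rw [h3] at h1; norm_num at h1
    · exact h3
  rw [energy_gramLin_eq_sum, norm_sq_eq_sum A, Finset.mul_sum]
  refine Finset.sum_le_sum fun j _ => ?_
  by_cases hj : (e j : ℕ) = 0
  · rw [← hu, hzero j hj]; simp
  · exact mul_le_mul_of_nonneg_right (hle j hj) (sq_nonneg _)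

theorem eig_zero_le_frobSq {v : Vec d} (hv : ‖v‖ = 1) (hev : gramMul A v = eig A 0 • v) :
    eig A 0 ≤ frobSq A := by
  have := energy_gramLin_le_frobSq A v
  rwa [energy, gramLin_apply, hev, real_inner_smul_right, real_inner_self_eq_norm_sq, hv, one_pow,
    mul_one, mul_one] at this

theorem frobSq_le : frobSq A ≤ d * eig A 0 := by
  have h1 : ∀ j, energy (gramLin A) (EuclideanSpace.single j (1 : ℝ)) = ∑ i, A i j ^ 2 := by
    intro j
    rw [energy_gramLin]
    refine Finset.sum_congr rfl fun i _ => ?_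
    rw [EuclideanSpace.inner_single_right]
    simp [row]
  calc frobSq A = ∑ j, energy (gramLin A) (EuclideanSpace.single j (1 : ℝ)) := by
        simp_rw [h1]
        exact Finset.sum_comm
    _ ≤ ∑ _j : Fin d, eig A 0 := by
        refine Finset.sum_le_sum fun j _ => ?_
        have := energy_gramLin_le A (EuclideanSpace.single j (1 : ℝ))
        simpa using this
    _ = d * eig A 0 := by simp

end Spectrum

namespace Comp

variable {α : Type}

/-- Telescoping over a loop whose body decreases `U` by `c * e` in expectation, up to `C`. -/
theorem expect_loop_add_sum_le {f : α → Comp α} {U e : α → ℝ≥0∞} {c C : ℝ≥0∞}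
    (h : ∀ a, expect (f a) U + c * e a ≤ U a + C) (k : ℕ) (a : α) :
    expect (loop f k a) U + c * ∑ t ∈ Finset.range k, expect (loop f t a) e ≤ U a + k * C := by
  induction k generalizing a with
  | zero => simp
  | succ k ih =>
    simp only [Finset.sum_range_succ', expect_loop_succ, expect_loop_zero]
    rw [← expect_sum, mul_add, ← add_assoc, ← expect_const_mul, ← expect_add]
    calc _ ≤ expect (f a) (fun b => U b + k * C) + c * e a := by
          gcongr
          exact expect_mono _ ih
      _ = (expect (f a) U + c * e a) + k * C := by rw [expect_add, expect_const]; ring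
      _ ≤ (U a + C) + k * C := add_le_add_left (h a) _
      _ = _ := by push_cast; ring

theorem sum_expect_loop_succ_le {f : α → Comp α} {U e : α → ℝ≥0∞} {c C : ℝ≥0∞}
    (h : ∀ a, expect (f a) U + c * e a ≤ U a + C) (k : ℕ) (a : α) :
    c * ∑ t ∈ Finset.range k, expect (loop f (t + 1) a) e ≤ U a + (k + 1) * C := by
  simp only [expect_loop_succ]
  rw [← expect_sum, ← expect_const_mul]
  calc _ ≤ expect (f a) (fun b => U b + k * C) :=
        expect_mono _ fun b => le_add_self.trans (expect_loop_add_sum_le h k b)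
    _ = expect (f a) U + k * C := by rw [expect_add, expect_const]
    _ ≤ U a + C + k * C := by gcongr; exact le_self_add.trans (h a)
    _ = _ := by ring

end Comp

/-- The hypotheses on the matrix and on the parameters of the algorithm. -/
structure Regime {n d : ℕ} (I : Input n d) (v : Vec d) : Prop where
  two_le : 2 ≤ d
  gap_pos : 0 < gap I.A
  le_nnz : d ≤ nnz I.A
  nnz_le : (nnz I.A : ℝ) ≤ d * srank I.A / gap I.A ^ 2
  le_lam : (1 + gap I.A / 150) * eig I.A 0 ≤ I.lam
  lam_le : I.lam ≤ (1 + gap I.A / 100) * eig I.A 0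
  le_mu : 10 / 11 * (I.lam - eig I.A 0) ≤ I.mu
  mu_le : I.mu ≤ I.lam - eig I.A 0
  norm_eq : ‖v‖ = 1
  eigen : gramMul I.A v = eig I.A 0 • v

namespace Input

variable {n d : ℕ} (I : Input n d)

/-- The shifted operator `lam • 1 - Aᵀ A` as a linear map. -/
def shiftLin : Vec d →ₗ[ℝ] Vec d := I.lam • LinearMap.id - gramLin I.A

theorem shiftLin_apply (x : Vec d) : I.shiftLin x = I.shiftMul x := rfl

theorem energy_shiftLin (x : Vec d) :
    energy I.shiftLin x = I.lam * ‖x‖ ^ 2 - energy (gramLin I.A) x := by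
  rw [energy, shiftLin_apply, shiftMul, inner_sub_right, real_inner_smul_right,
    real_inner_self_eq_norm_sq]
  rfl

theorem shiftLin_isSymmetric : I.shiftLin.IsSymmetric := fun x y => by
  have := gramLin_isSymmetric I.A x y
  simp only [gramLin_apply] at this
  simp only [shiftLin_apply, shiftMul, inner_sub_left, inner_sub_right, real_inner_smul_left,
    real_inner_smul_right, this]

end Input

namespace Regime

variable {n d : ℕ} {I : Input n d} {v : Vec d} (h : Regime I v)
include h

theorem eig_pos : 0 < eig I.A 0 := by
  refine lt_of_le_of_ne (eig_nonneg I.A 0) fun h0 => ?_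
  have := h.gap_pos
  rw [gap, ← h0, div_zero] at this
  exact lt_irrefl _ this

theorem gap_mul : gap I.A * eig I.A 0 = eig I.A 0 - eig I.A 1 := by
  rw [gap, div_mul_cancel₀ _ h.eig_pos.ne']

theorem gap_le_one : gap I.A ≤ 1 := by
  rw [gap, div_le_one h.eig_pos]
  linarith [eig_nonneg I.A 1]

/-- The distance `lam - λ₁` of the shift to the top eigenvalue. -/
theorem le_shift : gap I.A * eig I.A 0 / 150 ≤ I.lam - eig I.A 0 := by
  have := h.le_lam; linarith

theorem shift_le : I.lam - eig I.A 0 ≤ gap I.A * eig I.A 0 / 100 := by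
  have := h.lam_le; linarith

theorem gap_mul_pos : 0 < gap I.A * eig I.A 0 := mul_pos h.gap_pos h.eig_pos

theorem shift_pos : 0 < I.lam - eig I.A 0 := by
  have := h.le_shift; have := h.gap_mul_pos; linarith

theorem mu_pos : 0 < I.mu := by
  have := h.le_mu; have := h.shift_pos; linarith

theorem gap_mul_le : gap I.A * eig I.A 0 ≤ eig I.A 0 :=
  mul_le_of_le_one_left h.eig_pos.le h.gap_le_one

theorem eig_le_lamHat : eig I.A 0 ≤ I.lamHat := by
  have := h.mu_le; rw [Input.mu] at this; linarith

theorem lamHat_le : I.lamHat ≤ 1001 / 1000 * eig I.A 0 := by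
  have h1 := h.le_mu; have := h.shift_le; have := h.gap_mul_le
  have := h.eig_pos
  rw [Input.mu] at h1; linarith

theorem lamHat_pos : 0 < I.lamHat := h.eig_pos.trans_le h.eig_le_lamHat

theorem eig_le_frobSq : eig I.A 0 ≤ frobSq I.A := eig_zero_le_frobSq I.A h.norm_eq h.eigen

theorem frobSq_pos : 0 < frobSq I.A := h.eig_pos.trans_le h.eig_le_frobSq

theorem d_pos : (0 : ℝ) < d := by
  have := h.two_le; positivity

theorem d_le_nnz : (d : ℝ) ≤ nnz I.A := by exact_mod_cast h.le_nnz

theorem nnz_pos : (0 : ℝ) < nnz I.A := h.d_pos.trans_le h.d_le_nnz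

theorem lowMode : LowMode I.shiftLin v (I.lam - eig I.A 0) where
  symm := I.shiftLin_isSymmetric
  norm_eq := h.norm_eq
  eigen := by
    rw [Input.shiftLin_apply, Input.shiftMul, h.eigen, sub_smul]
  pos := h.shift_pos
  gap w hw := by
    have h1 := h.gap_mul
    have h2 := h.gap_mul_pos
    have h3 := energy_gramLin_le_of_orthogonal I.A (by linarith) h.norm_eq h.eigen hw
    have h4 := h.shift_le
    have h5 : 0 ≤ (I.lam - eig I.A 1 - 100 * (I.lam - eig I.A 0)) * ‖w‖ ^ 2 := by
      have := h.shift_pos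
      exact mul_nonneg (by linarith) (sq_nonneg _)
    rw [Input.energy_shiftLin]
    linarith

theorem mu_mul_le_energy (x : Vec d) : I.mu * ‖x‖ ^ 2 ≤ energy I.shiftLin x :=
  (mul_le_mul_of_nonneg_right h.mu_le (sq_nonneg _)).trans (h.lowMode.le_energy x)

theorem gamma_sq : I.gamma ^ 2 = d * I.lamHat * frobSq I.A / nnz I.A := by
  have := h.lamHat_pos; have := h.frobSq_pos
  rw [Input.gamma, Real.sq_sqrt (by positivity)]

theorem gamma_sq_le : I.gamma ^ 2 ≤ I.lamHat * frobSq I.A := by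
  have := h.lamHat_pos; have := h.frobSq_pos
  rw [h.gamma_sq, div_le_iff₀ h.nnz_pos]
  calc d * I.lamHat * frobSq I.A = I.lamHat * frobSq I.A * d := by ring
    _ ≤ _ := by gcongr; exact h.le_nnz

theorem gap_mul_le_gamma : gap I.A * eig I.A 0 ≤ I.gamma := by
  have hL := h.eig_pos; have hF := h.frobSq_pos; have hg := h.gap_pos; have := h.lamHat_pos
  refine Real.le_sqrt_of_sq_le ?_
  rw [le_div_iff₀ h.nnz_pos]
  calc (gap I.A * eig I.A 0) ^ 2 * nnz I.A
      ≤ (gap I.A * eig I.A 0) ^ 2 * (d * srank I.A / gap I.A ^ 2) := by gcongr; exact h.nnz_le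
    _ = d * eig I.A 0 * frobSq I.A := by rw [srank]; field_simp
    _ ≤ _ := by gcongr; exact h.eig_le_lamHat

theorem mu_le_gamma : 100 * I.mu ≤ I.gamma := by
  have := h.mu_le; have := h.shift_le; have := h.gap_mul_le_gamma
  linarith

theorem gamma_pos : 0 < I.gamma := by
  have := h.mu_pos; have := h.mu_le_gamma; linarith

theorem rho_ge : 201 ≤ I.rho := by
  rw [Input.rho, le_div_iff₀ h.mu_pos]
  have := h.mu_le_gamma
  linarith

theorem rho_pos : 0 < I.rho := by linarith [h.rho_ge]

theorem energy_shiftBy_ge (x : Vec d) :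
    (I.mu + I.gamma) * ‖x‖ ^ 2 ≤ energy (shiftBy I.shiftLin I.gamma) x := by
  rw [energy_shiftBy, add_mul]
  linarith [h.mu_mul_le_energy x]

theorem energy_shiftBy_nonneg (x : Vec d) : 0 ≤ energy (shiftBy I.shiftLin I.gamma) x := by
  have := h.mu_pos; have := h.gamma_pos
  exact le_trans (by positivity) (h.energy_shiftBy_ge x)

theorem variance_pos : 0 < I.variance := by
  have := h.mu_pos; have := h.gamma_pos; have := h.lamHat_pos; have := h.frobSq_pos
  rw [Input.variance]; positivity

theorem second_moment_le_variance (u : Vec d) :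
    (I.lam + I.gamma) ^ 2 * ‖u‖ ^ 2 - 2 * (I.lam + I.gamma) * energy (gramLin I.A) u
      + frobSq I.A * energy (gramLin I.A) u
      ≤ I.variance * energy (shiftBy I.shiftLin I.gamma) u := by
  have hmu := h.mu_pos
  have hga := h.gamma_pos
  have hF := h.frobSq_pos
  have hLH := h.lamHat_pos
  have hs0 := energy_gramLin_nonneg I.A u
  have hs1 := energy_gramLin_le I.A u
  have he := h.energy_shiftBy_ge u
  have heq : energy (shiftBy I.shiftLin I.gamma) u
      = (I.lam + I.gamma) * ‖u‖ ^ 2 - energy (gramLin I.A) u := by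
    rw [energy_shiftBy, Input.energy_shiftLin]; ring
  set s := energy (gramLin I.A) u
  set e := energy (shiftBy I.shiftLin I.gamma) u
  have he0 : 0 ≤ e := le_trans (by positivity) he
  have hlam : 0 < I.lam := by linarith [h.shift_pos, h.eig_pos]
  have h1 : (I.lam + I.gamma) ^ 2 * ‖u‖ ^ 2 - 2 * (I.lam + I.gamma) * s
      ≤ (I.lam + I.gamma) * e := by
    rw [heq]
    have : 0 ≤ (I.lam + I.gamma) * s := by positivity
    nlinarith
  have hX : I.lamHat ^ 2 ≤ 1001 / 1000 * (I.lamHat * frobSq I.A) := by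
    have : I.lamHat ≤ 1001 / 1000 * frobSq I.A := by linarith [h.lamHat_le, h.eig_le_frobSq]
    nlinarith
  have hG := h.gamma_sq_le
  have hlam' : I.lam ≤ 102 / 100 * I.lamHat := by
    linarith [h.shift_le, h.gap_mul_le, h.eig_le_lamHat]
  have hmu' : I.mu ≤ 1 / 100 * I.lamHat := by
    linarith [h.shift_le, h.gap_mul_le, h.eig_le_lamHat, h.mu_le]
  have h2 : (I.mu + I.gamma) * (I.lam + I.gamma)
      ≤ I.gamma ^ 2 / 2 + 5 * (I.lamHat * frobSq I.A) := by
    calc (I.mu + I.gamma) * (I.lam + I.gamma)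
        ≤ (1 / 100 * I.lamHat + I.gamma) * (102 / 100 * I.lamHat + I.gamma) := by gcongr
      _ ≤ _ := by nlinarith [sq_nonneg (I.lamHat - I.gamma)]
  have h3 : (I.mu + I.gamma) * (frobSq I.A * s) ≤ I.lamHat * frobSq I.A * e := by
    have : (I.mu + I.gamma) * s ≤ I.lamHat * e := by
      calc (I.mu + I.gamma) * s ≤ (I.mu + I.gamma) * (eig I.A 0 * ‖u‖ ^ 2) := by gcongr
        _ = eig I.A 0 * ((I.mu + I.gamma) * ‖u‖ ^ 2) := by ring
        _ ≤ I.lamHat * e := mul_le_mul h.eig_le_lamHat he (by positivity) hLH.le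
    calc _ = frobSq I.A * ((I.mu + I.gamma) * s) := by ring
      _ ≤ frobSq I.A * (I.lamHat * e) := by gcongr
      _ = _ := by ring
  have h4 : (I.mu + I.gamma) * ((I.lam + I.gamma) * e)
      ≤ (I.gamma ^ 2 / 2 + 5 * (I.lamHat * frobSq I.A)) * e := by
    rw [← mul_assoc]; gcongr
  have h5 : I.variance * e
      = (I.gamma ^ 2 / 2 + 6 * (I.lamHat * frobSq I.A)) * e / (I.mu + I.gamma) := by
    rw [Input.variance]; field_simp; ring
  rw [h5, le_div_iff₀ (by positivity)]
  have h6 := mul_le_mul_of_nonneg_right h1 (by positivity : 0 ≤ I.mu + I.gamma)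
  linarith

end Regime

namespace Input

variable {n d : ℕ} (I : Input n d)

theorem p_nonneg (i : Fin n) : 0 ≤ I.p i :=
  div_nonneg (rowSq_nonneg _ _) (frobSq_pos I.nonzero).le

theorem sum_p : ∑ i, I.p i = 1 := by
  simp only [p]
  rw [← Finset.sum_div]
  exact div_self (frobSq_pos I.nonzero).ne'

theorem row_eq_zero {i : Fin n} (hi : I.p i = 0) : row I.A i = 0 := by
  have h : rowSq I.A i = 0 := by
    rcases div_eq_zero_iff.1 hi with h | h
    · exact h
    · exact absurd h (frobSq_pos I.nonzero).ne'
  rw [← norm_row_sq] at h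
  simpa using h

theorem expect_draw_row (φ : Fin n → ℝ) (hφ : ∀ i, 0 ≤ φ i) :
    Comp.expect (Comp.draw (rowPMF I.A I.nonzero)) (fun i => ENNReal.ofReal (φ i))
      = ENNReal.ofReal (∑ i, I.p i * φ i) := by
  rw [Comp.expect_draw, tsum_fintype,
    ENNReal.ofReal_sum_of_nonneg fun i _ => mul_nonneg (I.p_nonneg i) (hφ i)]
  refine Finset.sum_congr rfl fun i _ => ?_
  rw [ENNReal.ofReal_mul (I.p_nonneg i)]
  rfl

/-- The importance-weighted action `(1 / pᵢ) (pᵢ (lam + γ) - aᵢ aᵢᵀ) u` of a component. -/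
def compMul (i : Fin n) (u : Vec d) : Vec d :=
  (I.lam + I.gamma) • u - ((1 / I.p i) * (inner ℝ (row I.A i) u : ℝ)) • row I.A i

theorem weighted_psiGrad_sub (b y x w : Vec d) {i : Fin n} (hi : I.p i ≠ 0) :
    (I.eta / I.p i) • (I.psiGrad b y i x - I.psiGrad b y i w)
      = I.eta • (I.compMul i x - I.compMul i w) := by
  simp only [psiGrad, compMul]
  match_scalars <;> field_simp <;> ring

theorem sum_p_inner_compMul (w u : Vec d) :
    ∑ i, I.p i * (inner ℝ w (I.compMul i u) : ℝ) = inner ℝ w (shiftBy I.shiftLin I.gamma u) := by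
  have h : ∀ i, I.p i * (inner ℝ w (I.compMul i u) : ℝ)
      = I.p i * ((I.lam + I.gamma) * inner ℝ w u)
        - (inner ℝ (row I.A i) w : ℝ) * inner ℝ (row I.A i) u := fun i => by
    rw [compMul, inner_sub_right, real_inner_smul_right, real_inner_smul_right,
      real_inner_comm (row I.A i) w]
    by_cases hi : I.p i = 0
    · simp [I.row_eq_zero hi]
    · field_simp
  simp_rw [h]
  rw [Finset.sum_sub_distrib, ← Finset.sum_mul, I.sum_p, ← inner_gramMul, shiftBy_apply,
    shiftLin_apply, shiftMul, inner_add_right, inner_sub_right, real_inner_smul_right,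
    real_inner_smul_right]
  ring

theorem sum_p_norm_compMul_sq (u : Vec d) :
    ∑ i, I.p i * ‖I.compMul i u‖ ^ 2
      = (I.lam + I.gamma) ^ 2 * ‖u‖ ^ 2 - 2 * (I.lam + I.gamma) * energy (gramLin I.A) u
        + frobSq I.A * energy (gramLin I.A) u := by
  have hF := frobSq_pos I.nonzero
  have h : ∀ i, I.p i * ‖I.compMul i u‖ ^ 2
      = I.p i * ((I.lam + I.gamma) ^ 2 * ‖u‖ ^ 2)
        + (frobSq I.A - 2 * (I.lam + I.gamma)) * (inner ℝ (row I.A i) u : ℝ) ^ 2 := fun i => by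
    by_cases hi : I.p i = 0
    · simp [I.row_eq_zero hi, hi]
    · have hr : ‖row I.A i‖ ^ 2 = I.p i * frobSq I.A := by
        rw [norm_row_sq, p, div_mul_cancel₀ _ hF.ne']
      rw [compMul, @norm_sub_sq ℝ, norm_smul, norm_smul, mul_pow, mul_pow, hr, Real.norm_eq_abs,
        sq_abs, Real.norm_eq_abs, sq_abs, RCLike.re_to_real, real_inner_smul_left,
        real_inner_smul_right, real_inner_comm (row I.A i) u]
      field_simp
      ring
  simp_rw [h]
  rw [Finset.sum_add_distrib, ← Finset.sum_mul, I.sum_p, ← Finset.mul_sum, energy_gramLin]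
  ring

end Input

namespace Regime

variable {n d : ℕ} {I : Input n d} {v : Vec d} (h : Regime I v)
include h

theorem eta_pos : 0 < I.eta := by
  have := h.variance_pos
  rw [Input.eta]; positivity

theorem eta_mul_variance : I.eta * I.variance = 1 / 8 := by
  have := h.variance_pos
  rw [Input.eta]; field_simp

/-- The expected squared distance to the minimizer after one stochastic step, where `u` and `w` are
the current iterate and the reference point relative to the minimizer. -/
theorem sum_p_step_le (u w : Vec d) :
    ∑ i, I.p i * ‖u - I.eta • (I.compMul i u - I.compMul i w + shiftBy I.shiftLin I.gamma w)‖ ^ 2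
      + 7 / 4 * I.eta * energy (shiftBy I.shiftLin I.gamma) u
      ≤ ‖u‖ ^ 2 + I.eta / 4 * energy (shiftBy I.shiftLin I.gamma) w := by
  set H := shiftBy I.shiftLin I.gamma with hH
  have hη := h.eta_pos
  have hηS := h.eta_mul_variance
  have hpt : ∀ i, I.p i * ‖u - I.eta • (I.compMul i u - I.compMul i w + H w)‖ ^ 2
      ≤ I.p i * ‖u‖ ^ 2 - 2 * I.eta * (I.p i * inner ℝ u (I.compMul i u))
        + 2 * I.eta * (I.p i * inner ℝ u (I.compMul i w)) - 2 * I.eta * (I.p i * inner ℝ u (H w))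
        + 2 * I.eta ^ 2 * (I.p i * ‖I.compMul i u‖ ^ 2)
        + 2 * I.eta ^ 2 * (I.p i * ‖I.compMul i w‖ ^ 2)
        - 4 * I.eta ^ 2 * (I.p i * inner ℝ (H w) (I.compMul i w))
        + 2 * I.eta ^ 2 * (I.p i * ‖H w‖ ^ 2) := fun i => by
    set a := I.compMul i u
    set c := I.compMul i w
    have h1 : ‖a - c + H w‖ ^ 2 ≤ 2 * ‖a‖ ^ 2 + 2 * ‖c - H w‖ ^ 2 := by
      have := norm_add_sq_le one_pos a (H w - c)
      rw [← norm_neg (H w - c), neg_sub] at this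
      rw [show a - c + H w = a + (H w - c) by abel]
      linarith
    rw [@norm_sub_sq ℝ _ _ _ _ c, RCLike.re_to_real, real_inner_comm] at h1
    have h2 : ‖u - I.eta • (a - c + H w)‖ ^ 2
        ≤ ‖u‖ ^ 2 - 2 * (I.eta * (inner ℝ u a - inner ℝ u c + inner ℝ u (H w)))
          + I.eta ^ 2 * (2 * ‖a‖ ^ 2
            + 2 * (‖c‖ ^ 2 - 2 * inner ℝ (H w) c + ‖H w‖ ^ 2)) := by
      rw [@norm_sub_sq ℝ, norm_smul, mul_pow, Real.norm_eq_abs, sq_abs, RCLike.re_to_real,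
        real_inner_smul_right, inner_add_right, inner_sub_right]
      gcongr
    calc _ ≤ I.p i * _ := mul_le_mul_of_nonneg_left h2 (I.p_nonneg i)
      _ = _ := by ring
  have hsum := Finset.sum_le_sum fun i (_ : i ∈ Finset.univ) => hpt i
  simp only [Finset.sum_add_distrib, Finset.sum_sub_distrib, ← Finset.mul_sum, ← Finset.sum_mul,
    I.sum_p, I.sum_p_inner_compMul, I.sum_p_norm_compMul_sq, ← hH] at hsum
  have hu := h.second_moment_le_variance u
  have hw := h.second_moment_le_variance w
  rw [← hH] at hu hw
  have hu' := mul_le_mul_of_nonneg_left hu (by positivity : 0 ≤ 2 * I.eta ^ 2)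
  have hw' := mul_le_mul_of_nonneg_left hw (by positivity : 0 ≤ 2 * I.eta ^ 2)
  have e1 : ∀ e : ℝ, 2 * I.eta ^ 2 * (I.variance * e) = I.eta / 4 * e := fun e => by
    rw [show 2 * I.eta ^ 2 * (I.variance * e) = 2 * I.eta * (I.eta * I.variance) * e by ring, hηS]
    ring
  rw [e1] at hu' hw'
  rw [real_inner_self_eq_norm_sq] at hsum
  have hue : (inner ℝ u (H u) : ℝ) = energy H u := rfl
  rw [hue] at hsum
  have : 0 ≤ 2 * I.eta ^ 2 * ‖H w‖ ^ 2 := by positivity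
  linarith

theorem expect_svrgStep_le {b y xp : Vec d} (hxp : I.shiftLin xp - b + I.gamma • (xp - y) = 0)
    (w x : Vec d) :
    (I.svrgStep b y w (I.fullGrad b y w) x).expect (fun z => ENNReal.ofReal (‖z - xp‖ ^ 2))
      + ENNReal.ofReal (7 / 4 * I.eta)
        * ENNReal.ofReal (energy (shiftBy I.shiftLin I.gamma) (x - xp))
      ≤ ENNReal.ofReal (‖x - xp‖ ^ 2)
        + ENNReal.ofReal (I.eta / 4 * energy (shiftBy I.shiftLin I.gamma) (w - xp)) := by
  have hη := h.eta_pos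
  have hg : I.fullGrad b y w = shiftBy I.shiftLin I.gamma (w - xp) := by
    have : I.fullGrad b y w - (I.shiftLin xp - b + I.gamma • (xp - y))
        = shiftBy I.shiftLin I.gamma (w - xp) := by
      rw [Input.fullGrad, ← Input.shiftLin_apply, shiftBy_apply, map_sub]
      module
    rwa [hxp, sub_zero] at this
  simp only [Input.svrgStep, Comp.expect_bind, Comp.expect_paid]
  rw [I.expect_draw_row _ fun i => sq_nonneg _, ← ENNReal.ofReal_mul (by positivity),
    ← ENNReal.ofReal_add (Finset.sum_nonneg fun i _ => mul_nonneg (I.p_nonneg i) (sq_nonneg _))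
      (mul_nonneg (by positivity) (h.energy_shiftBy_nonneg _)),
    ← ENNReal.ofReal_add (sq_nonneg _) (mul_nonneg (by positivity) (h.energy_shiftBy_nonneg _))]
  refine ENNReal.ofReal_le_ofReal ?_
  refine le_trans (le_of_eq ?_) (h.sum_p_step_le (x - xp) (w - xp))
  congr 1
  refine Finset.sum_congr rfl fun i _ => ?_
  by_cases hi : I.p i = 0
  · rw [hi, zero_mul, zero_mul]
  · rw [I.weighted_psiGrad_sub b y x w hi, hg]
    congr 3
    simp only [Input.compMul, inner_sub_right]
    module

theorem epoch_length : 8 ≤ I.eta * (I.epochMax + 1) * (I.mu + I.gamma) := by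
  have hS := h.variance_pos
  have hmu := h.mu_pos
  have hga := h.gamma_pos
  have h1 : 64 * I.variance / (I.mu + I.gamma) ≤ I.epochMax + 1 := (Nat.lt_floor_add_one _).le
  rw [div_le_iff₀ (by positivity)] at h1
  calc (8 : ℝ) = I.eta * (64 * I.variance) := by linarith [h.eta_mul_variance]
    _ ≤ I.eta * ((I.epochMax + 1) * (I.mu + I.gamma)) := by
        gcongr; exact h.eta_pos.le
    _ = _ := by ring

/-- One epoch of SVRG reduces the expected suboptimality by a constant factor. -/
theorem expect_svrgEpoch_le {b y xp : Vec d} (hxp : I.shiftLin xp - b + I.gamma • (xp - y) = 0)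
    (w : Vec d) :
    (I.svrgEpoch b y w).expect
        (fun z => ENNReal.ofReal (energy (shiftBy I.shiftLin I.gamma) (z - xp)))
      ≤ ENNReal.ofReal (5 / 14)
        * ENNReal.ofReal (energy (shiftBy I.shiftLin I.gamma) (w - xp)) := by
  have hη := h.eta_pos
  have hmg : 0 < I.mu + I.gamma := add_pos h.mu_pos h.gamma_pos
  have hlen := h.epoch_length
  set H := shiftBy I.shiftLin I.gamma with hH
  have he0 : 0 ≤ energy H (w - xp) := h.energy_shiftBy_nonneg _
  have hU : ‖w - xp‖ ^ 2 ≤ energy H (w - xp) / (I.mu + I.gamma) := by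
    rw [le_div_iff₀ hmg, mul_comm]
    exact h.energy_shiftBy_ge _
  set e := energy H (w - xp) with he
  set f := I.svrgStep b y w (I.fullGrad b y w) with hf
  set φ : Vec d → ℝ≥0∞ := fun z => ENNReal.ofReal (energy H (z - xp)) with hφ
  have hN : (0 : ℝ) < I.epochMax + 1 := by positivity
  have hsum := Comp.sum_expect_loop_succ_le (h.expect_svrgStep_le hxp w) (I.epochMax + 1) w
  rw [← hf, ← hH, ← hφ, ← he] at hsum
  simp only [Input.svrgEpoch, Comp.expect_bind, Comp.expect_paid]
  rw [Comp.expect_draw, tsum_fintype]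
  simp only [PMF.uniformOfFintype_apply, Fintype.card_fin]
  rw [← Finset.mul_sum, ← hf,
    Fin.sum_univ_eq_sum_range (fun t => (Comp.loop f (t + 1) w).expect φ) (I.epochMax + 1)]
  set T := ∑ t ∈ Finset.range (I.epochMax + 1), (Comp.loop f (t + 1) w).expect φ
  have hT : T ≤ ENNReal.ofReal ((e / (I.mu + I.gamma) + (I.epochMax + 2) * (I.eta / 4 * e))
      / (7 / 4 * I.eta)) := by
    rw [ENNReal.ofReal_div_of_pos (by positivity), ENNReal.le_div_iff_mul_le
      (Or.inl (by simpa using hη)) (Or.inl ENNReal.ofReal_ne_top), mul_comm]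
    refine hsum.trans ?_
    rw [ENNReal.ofReal_add (by positivity) (by positivity),
      ENNReal.ofReal_mul (by positivity : (0 : ℝ) ≤ I.epochMax + 2)]
    refine add_le_add (ENNReal.ofReal_le_ofReal hU) (le_of_eq ?_)
    congr 1
    rw [show (I.epochMax : ℝ) + 2 = ((I.epochMax + 1 + 1 : ℕ) : ℝ) by push_cast; ring,
      ENNReal.ofReal_natCast]
    push_cast; ring
  have hcast : ((I.epochMax + 1 : ℕ) : ℝ≥0∞)⁻¹ = ENNReal.ofReal (1 / (I.epochMax + 1)) := by
    rw [one_div, ENNReal.ofReal_inv_of_pos hN]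
    congr 1
    rw [show (I.epochMax : ℝ) + 1 = ((I.epochMax + 1 : ℕ) : ℝ) by push_cast; ring,
      ENNReal.ofReal_natCast]
  calc _ ≤ ENNReal.ofReal (1 / (I.epochMax + 1)) * ENNReal.ofReal
        ((e / (I.mu + I.gamma) + (I.epochMax + 2) * (I.eta / 4 * e)) / (7 / 4 * I.eta)) := by
        rw [hcast]; gcongr
    _ ≤ _ := by
        rw [← ENNReal.ofReal_mul (by positivity), ← ENNReal.ofReal_mul (by positivity)]
        refine ENNReal.ofReal_le_ofReal ?_
        have h1 : 1 / (I.mu + I.gamma) ≤ I.eta * (I.epochMax + 1) / 8 := by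
          rw [div_le_div_iff₀ hmg (by norm_num)]; linarith
        have h2 : (I.epochMax : ℝ) + 2 ≤ 2 * (I.epochMax + 1) := by
          have : (0 : ℝ) ≤ I.epochMax := by positivity
          linarith
        calc _ = 1 / (I.epochMax + 1) * ((1 / (I.mu + I.gamma) * e
              + (I.epochMax + 2) * (I.eta / 4 * e)) / (7 / 4 * I.eta)) := by ring
          _ ≤ 1 / (I.epochMax + 1) * ((I.eta * (I.epochMax + 1) / 8 * e
              + 2 * (I.epochMax + 1) * (I.eta / 4 * e)) / (7 / 4 * I.eta)) := by gcongr
          _ = 5 / 14 * e := by field_simp; ring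

theorem log_rho_pos : 0 < Real.log I.rho := Real.log_pos (by linarith [h.rho_ge])

/-- The approximate proximal step has expected relative error at most `ρ ^ (-K)`. -/
theorem expect_proxStep_le (K : ℕ) {b y xp : Vec d}
    (hxp : I.shiftLin xp - b + I.gamma • (xp - y) = 0) :
    (I.proxStep K b y).expect
        (fun z => ENNReal.ofReal (energy (shiftBy I.shiftLin I.gamma) (z - xp)))
      ≤ ENNReal.ofReal ((1 / I.rho) ^ K)
        * ENNReal.ofReal (energy (shiftBy I.shiftLin I.gamma) (y - xp)) := by
  refine (Comp.expect_loop_le (h.expect_svrgEpoch_le hxp) _ y).trans ?_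
  rw [← ENNReal.ofReal_pow (by norm_num)]
  gcongr
  have hρ := h.rho_pos
  have h1 : (5 / 14 : ℝ) ≤ Real.exp (-1) := by
    rw [Real.exp_neg, le_inv_comm₀ (by norm_num) (Real.exp_pos _)]
    have := Real.exp_one_lt_d9
    norm_num at this ⊢
    linarith
  calc (5 / 14 : ℝ) ^ ⌈K * Real.log I.rho⌉₊ ≤ Real.exp (-1) ^ ⌈K * Real.log I.rho⌉₊ := by gcongr
    _ = Real.exp (-(⌈K * Real.log I.rho⌉₊ : ℝ)) := by rw [← Real.exp_nat_mul]; ring_nf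
    _ ≤ Real.exp (-(K * Real.log I.rho)) := by
        gcongr; exact Nat.le_ceil _
    _ = (1 / I.rho) ^ K := by
        rw [← mul_neg, Real.exp_nat_mul, Real.exp_neg, Real.exp_log hρ, one_div]

end Regime

/-- The factor by which one run of the accelerated solver reduces the expected error. -/
def solveRate (K : ℕ) : ℝ := 3 * Real.exp (-(K / 8))

theorem solveRate_nonneg (K : ℕ) : 0 ≤ solveRate K := by
  rw [solveRate]; positivity

namespace Input

variable {n d : ℕ} (I : Input n d)

/-- The momentum parameter `ρ ^ (-1/2)`. -/
def momentum : ℝ := 1 / √I.rho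

/-- The convexity parameter of the Moreau envelope that governs the momentum step. -/
def envelopeConvexity : ℝ := I.momentum ^ 2 * I.gamma

/-- The potential of the accelerated method around the solution `z`. -/
def potential (z : Vec d) (s : Vec d × Vec d) : ℝ :=
  accelPotential I.shiftLin I.envelopeConvexity (I.momentum ^ 3 / 8) (s.1 - z) (s.2 - z)

end Input

namespace Regime

variable {n d : ℕ} {I : Input n d} {v : Vec d} (h : Regime I v)
include h

theorem momentum_pos : 0 < I.momentum := by
  have := h.rho_pos
  rw [Input.momentum]; positivity

theorem momentum_sq : I.momentum ^ 2 = 1 / I.rho := by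
  rw [Input.momentum, div_pow, one_pow, Real.sq_sqrt h.rho_pos.le]

theorem momentum_le : I.momentum ≤ 1 / 14 := by
  refine abs_le_of_sq_le_sq' ?_ (by norm_num) |>.2
  rw [h.momentum_sq, div_le_iff₀ h.rho_pos]
  linarith [h.rho_ge]

theorem envelopeConvexity_pos : 0 < I.envelopeConvexity :=
  mul_pos (pow_pos h.momentum_pos 2) h.gamma_pos

theorem envelopeConvexity_mul :
    I.envelopeConvexity * (I.mu / 2 + I.gamma) = I.mu / 2 * I.gamma := by
  have := h.mu_pos; have := h.gamma_pos
  rw [Input.envelopeConvexity, h.momentum_sq, Input.rho]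
  field_simp
  ring

theorem inv_envelopeConvexity :
    1 / (I.mu / 2) + 1 / I.gamma = 1 / I.envelopeConvexity := by
  have := h.mu_pos; have := h.gamma_pos; have := h.envelopeConvexity_pos
  have h1 := h.envelopeConvexity_mul
  field_simp
  linarith

theorem half_mu_mul_le_energy (x : Vec d) : I.mu / 2 * ‖x‖ ^ 2 ≤ energy I.shiftLin x := by
  have h1 := h.mu_mul_le_energy x
  have h2 : 0 ≤ I.mu * ‖x‖ ^ 2 := mul_nonneg h.mu_pos.le (sq_nonneg _)
  linarith

theorem potential_nonneg (z : Vec d) (s : Vec d × Vec d) : 0 ≤ I.potential z s := by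
  have := h.momentum_pos
  exact accelPotential_nonneg h.lowMode.energy_nonneg h.envelopeConvexity_pos.le (by positivity) _ _

theorem energy_le_potential (z : Vec d) (s : Vec d × Vec d) :
    energy I.shiftLin (s.1 - z) ≤ I.potential z s := by
  have := h.momentum_pos
  have h1 := mul_nonneg h.envelopeConvexity_pos.le (sq_nonneg ‖s.2 - z‖)
  have h2 := mul_nonneg (by positivity : 0 ≤ I.momentum ^ 3 / 8)
    (h.lowMode.energy_nonneg (s.2 - z))
  rw [Input.potential, accelPotential]
  linarith

theorem potential_diag_le (z x : Vec d) :
    I.potential z (x, x) ≤ 3 * energy I.shiftLin (x - z) := by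
  have hα := h.momentum_pos
  have hα1 := h.momentum_le
  have h1 : I.envelopeConvexity * ‖x - z‖ ^ 2 ≤ energy I.shiftLin (x - z) := by
    refine le_trans (mul_le_mul_of_nonneg_right ?_ (sq_nonneg _)) (h.half_mu_mul_le_energy _)
    have := h.mu_pos; have := h.gamma_pos; have := h.envelopeConvexity_pos
    have h2 := h.envelopeConvexity_mul
    refine le_of_mul_le_mul_right ?_ h.gamma_pos
    nlinarith
  have h2 : I.momentum ^ 3 / 8 * energy I.shiftLin (x - z) ≤ 1 * energy I.shiftLin (x - z) := by
    refine mul_le_mul_of_nonneg_right ?_ (h.lowMode.energy_nonneg _)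
    have : I.momentum ^ 3 ≤ 1 := pow_le_one₀ hα.le (by linarith)
    linarith
  rw [Input.potential, accelPotential]
  linarith

theorem exists_prox (b y : Vec d) : ∃ xp, I.shiftLin xp - b + I.gamma • (xp - y) = 0 := by
  obtain ⟨xp, hxp⟩ := exists_preimage_of_energy_ge (B := shiftBy I.shiftLin I.gamma)
    (add_pos h.mu_pos h.gamma_pos) h.energy_shiftBy_ge (b + I.gamma • y)
  refine ⟨xp, ?_⟩
  rw [shiftBy_apply] at hxp
  rw [smul_sub, sub_add_sub_comm, hxp, sub_self]

theorem exists_solution (b : Vec d) : ∃ z, I.shiftLin z = b :=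
  exists_preimage_of_energy_ge h.mu_pos h.mu_mul_le_energy b

/-- One accelerated step reduces the expected potential by the factor `1 - ρ ^ (-1/2) / 8`. -/
theorem expect_accelStep_le {K : ℕ} (hK : 4 ≤ K) {b z : Vec d} (hz : I.shiftLin z = b)
    (s : Vec d × Vec d) :
    (I.accelStep K b s).expect (fun s => ENNReal.ofReal (I.potential z s))
      ≤ ENNReal.ofReal (1 - I.momentum / 8) * ENNReal.ofReal (I.potential z s) := by
  obtain ⟨x, u⟩ := s
  have hα := h.momentum_pos
  have hα1 := h.momentum_le
  have hγ := h.gamma_pos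
  have hm := h.envelopeConvexity_pos
  set α := I.momentum with hαdef
  set m := I.envelopeConvexity with hmdef
  set y : Vec d := (1 / (1 + α)) • x + (α / (1 + α)) • u with hy
  obtain ⟨xp, hxp⟩ := h.exists_prox b y
  have hyrel : y - z = (1 / (1 + α)) • (x - z) + (α / (1 + α)) • (u - z) := by
    rw [hy]; match_scalars
    all_goals field_simp
    ring
  have hyrel' : (1 + α) • (y - z) = (x - z) + α • (u - z) := by
    rw [hyrel]; match_scalars
    all_goals field_simp
  have hprox : I.gamma • ((y - z) - (xp - z)) = I.shiftLin (xp - z) := by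
    rw [map_sub, hz, ← sub_eq_zero, ← neg_eq_zero, ← hxp]; module
  have hstep : ∀ x' : Vec d, I.potential z
      (x', (1 - α) • u + α • (y - (1 / (I.mu / 2) + 1 / I.gamma) • (I.gamma • (y - x'))))
      ≤ (1 - α / 4) * I.potential z (x, u)
        + 10 / α * energy (shiftBy I.shiftLin I.gamma) (x' - xp) := fun x' => by
    have h1 := accel_inexact_step I.shiftLin_isSymmetric (half_pos h.mu_pos) hγ
      h.half_mu_mul_le_energy h.envelopeConvexity_mul hα (by linarith) rfl hyrel' hprox
      (z := x' - z)
    rw [← hmdef, show x' - z - (xp - z) = x' - xp by abel] at h1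
    rw [h.inv_envelopeConvexity]
    refine le_trans (le_of_eq ?_) h1
    rw [Input.potential, ← hαdef, ← hmdef]
    congr 1
    module
  have hdisp : energy (shiftBy I.shiftLin I.gamma) (y - xp)
      ≤ 8 / α ^ 3 * I.potential z (x, u) := by
    have h1 := energy_prox_displacement_le I.shiftLin_isSymmetric h.lowMode.energy_nonneg hγ hprox
    rw [show y - z - (xp - z) = y - xp by abel] at h1
    refine h1.trans ?_
    rw [hyrel]
    exact energy_extrapolation_le I.shiftLin_isSymmetric h.lowMode.energy_nonneg hm.le hα
      (by linarith) _ _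
  have hP := h.potential_nonneg z (x, u)
  simp only [Input.accelStep, Comp.expect_bind, Comp.expect_paid, Comp.expect_pure]
  change (I.proxStep K b y).expect _ ≤ _
  calc _ ≤ (I.proxStep K b y).expect (fun x' => ENNReal.ofReal ((1 - α / 4) * I.potential z (x, u))
          + ENNReal.ofReal (10 / α)
            * ENNReal.ofReal (energy (shiftBy I.shiftLin I.gamma) (x' - xp))) := by
        refine Comp.expect_mono _ fun x' => ?_
        rw [← ENNReal.ofReal_mul (by positivity), ← ENNReal.ofReal_add
          (mul_nonneg (by linarith) hP) (mul_nonneg (by positivity) (h.energy_shiftBy_nonneg _))]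
        exact ENNReal.ofReal_le_ofReal (hstep x')
    _ = ENNReal.ofReal ((1 - α / 4) * I.potential z (x, u)) + ENNReal.ofReal (10 / α)
          * (I.proxStep K b y).expect
            (fun x' => ENNReal.ofReal (energy (shiftBy I.shiftLin I.gamma) (x' - xp))) := by
        rw [Comp.expect_add, Comp.expect_const, Comp.expect_const_mul]
    _ ≤ ENNReal.ofReal ((1 - α / 4) * I.potential z (x, u)) + ENNReal.ofReal (10 / α)
          * (ENNReal.ofReal ((1 / I.rho) ^ K)
            * ENNReal.ofReal (8 / α ^ 3 * I.potential z (x, u))) := by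
        gcongr
        refine (h.expect_proxStep_le K hxp).trans ?_
        gcongr
    _ ≤ _ := by
        have hρ := h.rho_pos
        rw [← h.momentum_sq, ← hαdef, ← ENNReal.ofReal_mul (by positivity),
          ← ENNReal.ofReal_mul (by positivity), ← ENNReal.ofReal_mul (by linarith),
          ← ENNReal.ofReal_add (mul_nonneg (by linarith) hP) (by positivity)]
        refine ENNReal.ofReal_le_ofReal ?_
        have h1 : (α ^ 2) ^ K ≤ α ^ 5 * (1 / 14) ^ 3 :=
          calc (α ^ 2) ^ K ≤ (α ^ 2) ^ 4 :=
                pow_le_pow_of_le_one (by positivity) (by nlinarith) hK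
            _ = α ^ 5 * α ^ 3 := by ring
            _ ≤ _ := by gcongr
        have h2 : 10 / α * ((α ^ 2) ^ K * (8 / α ^ 3)) ≤ α / 8 :=
          calc _ ≤ 10 / α * (α ^ 5 * (1 / 14) ^ 3 * (8 / α ^ 3)) := by gcongr
            _ = 80 / 2744 * α := by field_simp; norm_num
            _ ≤ α / 8 := by linarith
        calc _ = (1 - α / 4 + 10 / α * ((α ^ 2) ^ K * (8 / α ^ 3))) * I.potential z (x, u) := by
              ring
          _ ≤ _ := by gcongr; linarith

/-- One run of the accelerated solver. -/
theorem expect_accelSolve_le {K : ℕ} (hK : 4 ≤ K) {b z : Vec d} (hz : I.shiftLin z = b)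
    (x : Vec d) :
    (I.accelSolve K b x).expect (fun x => ENNReal.ofReal (energy I.shiftLin (x - z)))
      ≤ ENNReal.ofReal (solveRate K) * ENNReal.ofReal (energy I.shiftLin (x - z)) := by
  have hα := h.momentum_pos
  have hα1 := h.momentum_le
  have hρ := h.rho_pos
  simp only [Input.accelSolve, Comp.expect_bind, Comp.expect_pure]
  calc _ ≤ (Comp.loop (I.accelStep K b) ⌈K * √I.rho⌉₊ (x, x)).expect
        (fun s => ENNReal.ofReal (I.potential z s)) :=
        Comp.expect_mono _ fun s => ENNReal.ofReal_le_ofReal (h.energy_le_potential z s)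
    _ ≤ ENNReal.ofReal (1 - I.momentum / 8) ^ ⌈K * √I.rho⌉₊
        * ENNReal.ofReal (I.potential z (x, x)) :=
        Comp.expect_loop_le (h.expect_accelStep_le hK hz) _ _
    _ ≤ _ := by
        rw [← ENNReal.ofReal_pow (by linarith), ← ENNReal.ofReal_mul
          (pow_nonneg (by linarith) _), ← ENNReal.ofReal_mul (solveRate_nonneg K)]
        refine ENNReal.ofReal_le_ofReal ?_
        have h1 : (1 - I.momentum / 8) ^ ⌈K * √I.rho⌉₊ ≤ Real.exp (-(K / 8)) :=
          calc _ ≤ Real.exp (-(I.momentum / 8)) ^ ⌈K * √I.rho⌉₊ := by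
                refine pow_le_pow_left₀ (by linarith) ?_ _
                linarith [Real.add_one_le_exp (-(I.momentum / 8))]
            _ = Real.exp (-(⌈K * √I.rho⌉₊ * (I.momentum / 8))) := by
                rw [← Real.exp_nat_mul]; ring_nf
            _ ≤ Real.exp (-(K * √I.rho * (I.momentum / 8))) := by
                gcongr; exact Nat.le_ceil _
            _ = _ := by
                rw [Input.momentum]; congr 1; field_simp
        calc _ ≤ Real.exp (-(K / 8)) * (3 * energy I.shiftLin (x - z)) :=
              mul_le_mul h1 (h.potential_diag_le z x) (h.potential_nonneg z _) (Real.exp_pos _).le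
          _ = _ := by rw [solveRate]; ring

/-- The expected error of the approximate application of the inverse to a unit vector. -/
theorem expect_solve_le {K : ℕ} (hK : 4 ≤ K) (r : ℕ) {x z : Vec d} (hx : ‖x‖ = 1)
    (hz : I.shiftLin z = x) :
    (I.solve K r x).expect (fun y => ENNReal.ofReal (energy I.shiftLin (y - z)))
      ≤ ENNReal.ofReal (solveRate K ^ r
        * (energy I.shiftLin (perp v x) / (I.lam - eig I.A 0) ^ 2)) := by
  simp only [Input.solve, Comp.expect_bind, Comp.expect_paid]
  refine (Comp.expect_loop_le (h.expect_accelSolve_le hK hz) r _).trans ?_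
  rw [← ENNReal.ofReal_pow (solveRate_nonneg K),
    ← ENNReal.ofReal_mul (pow_nonneg (solveRate_nonneg K) r)]
  refine ENNReal.ofReal_le_ofReal ?_
  refine mul_le_mul_of_nonneg_left ?_ (pow_nonneg (solveRate_nonneg K) r)
  exact h.lowMode.initial_error_le hx hz

end Regime

namespace Comp

variable {α : Type}

/-- Markov's inequality for a real-valued error. -/
theorem failProb_le_div (m : Comp α) {S : Set α} {err : α → ℝ} {t R : ℝ} (ht : 0 < t)
    (h : ∀ a ∉ S, t ≤ err a)
    (hR : expect m (fun a => ENNReal.ofReal (err a)) ≤ ENNReal.ofReal R) :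
    m.failProb S ≤ ENNReal.ofReal (R / t) := by
  rw [ENNReal.ofReal_div_of_pos ht, ENNReal.le_div_iff_mul_le (Or.inl (by simpa using ht))
    (Or.inl ENNReal.ofReal_ne_top), mul_comm]
  exact (mul_failProb_le m fun a ha => ENNReal.ofReal_le_ofReal (h a ha)).trans hR

end Comp

theorem solveRate_hundred_le : solveRate 100 ≤ 1 / 10000 := by
  have h1 : (2.7 : ℝ) ^ 12 ≤ Real.exp (25 / 2) :=
    calc (2.7 : ℝ) ^ 12 ≤ Real.exp 1 ^ 12 := by
          gcongr; linarith [Real.exp_one_gt_d9]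
      _ = Real.exp 12 := by rw [← Real.exp_nat_mul]; norm_num
      _ ≤ _ := by gcongr; norm_num
  rw [solveRate, show -(((100 : ℕ) : ℝ) / 8) = -(25 / 2) by norm_num, Real.exp_neg,
    ← div_eq_mul_inv, div_le_div_iff₀ (Real.exp_pos _) (by norm_num)]
  norm_num at h1
  linarith

namespace Input

variable {n d : ℕ} (I : Input n d)

/-- The invariant after `k` rounds of the burn-in phase. -/
def burnInSet (v : Vec d) (Q : ℝ) (k : ℕ) : Set (Vec d) :=
  {x | ‖x‖ = 1 ∧ (inner ℝ v x : ℝ) ≠ 0 ∧ energy I.shiftLin (perp v x)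
    ≤ (Q / 2 ^ k + 1 / 100) * ((I.lam - eig I.A 0) * (inner ℝ v x : ℝ) ^ 2)}

/-- The warm unit vectors, close to `v` in the norm of the shifted operator. -/
def warmSet (v : Vec d) : Set (Vec d) :=
  {x | ‖x‖ = 1 ∧ energy I.shiftLin (perp v x) ≤ 17 / 100 * (I.lam - eig I.A 0)}

open Classical in
/-- The potential of the main phase. -/
def warmPotential (v x : Vec d) : ℝ≥0∞ :=
  if x ∈ I.warmSet v then ENNReal.ofReal (energy I.shiftLin (perp v x)) else ⊤

theorem normalize_mem_burnInSet {z : Vec d} {Q : ℝ} {k : ℕ} (hc : (inner ℝ v z : ℝ) ≠ 0)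
    (hz : energy I.shiftLin (perp v z)
      ≤ (Q / 2 ^ k + 1 / 100) * ((I.lam - eig I.A 0) * (inner ℝ v z : ℝ) ^ 2)) :
    (1 / ‖z‖) • z ∈ I.burnInSet v Q k := by
  have hz0 : z ≠ 0 := by rintro rfl; simp at hc
  have hn : 0 < ‖z‖ := norm_pos_iff.2 hz0
  refine ⟨?_, ?_, ?_⟩
  · rw [norm_smul, norm_div, norm_one, norm_norm, one_div_mul_cancel hn.ne']
  · rw [real_inner_smul_right]; exact mul_ne_zero (by positivity) hc
  · rw [perp_smul, energy_smul, real_inner_smul_right, mul_pow]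
    calc _ ≤ (1 / ‖z‖) ^ 2 * ((Q / 2 ^ k + 1 / 100)
          * ((I.lam - eig I.A 0) * (inner ℝ v z : ℝ) ^ 2)) := by gcongr
      _ = _ := by ring

theorem quot_iff {z : Vec d} (hz : z ≠ 0) :
    I.lamHat - (I.lam - I.lamHat) / 6 ≤ I.quot z
      ↔ energy I.shiftLin z ≤ 7 / 6 * I.mu * ‖z‖ ^ 2 := by
  have hn : 0 < ‖z‖ ^ 2 := by positivity
  rw [Input.quot, real_inner_self_eq_norm_sq, le_div_iff₀ hn, Input.energy_shiftLin, energy,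
    gramLin_apply, Input.mu]
  constructor <;> intro h1 <;> linarith

end Input

namespace Regime

variable {n d : ℕ} {I : Input n d} {v : Vec d} (h : Regime I v)
include h

theorem failProb_burnInStep_le {K : ℕ} (hK : 4 ≤ K) {Q : ℝ} (hQ : 0 ≤ Q) (k : ℕ) {x : Vec d}
    (hx : x ∈ I.burnInSet v Q k) :
    (I.burnInStep K x).failProb (I.burnInSet v Q (k + 1))
      ≤ ENNReal.ofReal (10000 * (solveRate K ^ I.burnInCount K * (Q + 1))) := by
  obtain ⟨hx1, hc, hxe⟩ := hx
  obtain ⟨z', hz'⟩ := h.exists_solution x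
  have hb := h.shift_pos
  set b₁ := I.lam - eig I.A 0
  set q : ℝ := Q / 2 ^ k + 1 / 100
  have hq0 : 0 ≤ q := by positivity
  have hq1 : q ≤ Q + 1 := by
    have : Q / 2 ^ k ≤ Q := div_le_self hQ (one_le_pow₀ (by norm_num))
    simp only [q]; linarith
  have hc2 : 0 < (inner ℝ v x : ℝ) ^ 2 := by positivity
  have hrate := pow_nonneg (solveRate_nonneg K) (I.burnInCount K)
  have hfail : (I.burnInStep K x).failProb (I.burnInSet v Q (k + 1))
      = (I.solve K (I.burnInCount K) x).failProb
        {z | (1 / ‖z‖) • z ∈ I.burnInSet v Q (k + 1)} := by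
    simp only [Comp.failProb, Input.burnInStep, Input.normalize, Comp.expect_bind,
      Comp.expect_paid]
    rfl
  rw [hfail]
  refine (Comp.failProb_le_div _ (err := fun z => energy I.shiftLin (z - z'))
    (t := (1 / 100) ^ 2 * (inner ℝ v x : ℝ) ^ 2 / b₁) (by positivity) (fun z hz => ?_)
    (h.expect_solve_le hK _ hx1 hz')).trans ?_
  · by_contra! hlt
    refine hz ?_
    obtain ⟨h1, h2⟩ := h.lowMode.burnIn_step hz' hc hq0 hxe hlt.le
    refine I.normalize_mem_burnInSet h1 (h2.trans ?_)
    gcongr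
    have h3 : Q / 2 ^ (k + 1) = Q / 2 ^ k / 2 := by rw [pow_succ, div_div]
    have h4 : 0 ≤ Q / 2 ^ k := by positivity
    rw [h3]
    simp only [q]
    linarith
  · refine ENNReal.ofReal_le_ofReal ?_
    rw [div_le_iff₀ (by positivity)]
    calc _ ≤ solveRate K ^ I.burnInCount K
          * ((q * (b₁ * (inner ℝ v x : ℝ) ^ 2)) / b₁ ^ 2) := by gcongr
      _ ≤ solveRate K ^ I.burnInCount K
          * (((Q + 1) * (b₁ * (inner ℝ v x : ℝ) ^ 2)) / b₁ ^ 2) := by gcongr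
      _ = _ := by field_simp; norm_num

theorem burnInSet_subset_warmSet {Q : ℝ} {k : ℕ} (hk : Q / 2 ^ k ≤ 1 / 100) :
    I.burnInSet v Q k ⊆ I.warmSet v := by
  rintro x ⟨hx, -, he⟩
  refine ⟨hx, he.trans ?_⟩
  have hb := h.shift_pos
  have h1 := norm_sq_eq_add_perp h.norm_eq x
  rw [hx] at h1
  have h2 : (inner ℝ v x : ℝ) ^ 2 ≤ 1 := by nlinarith [sq_nonneg ‖perp v x‖]
  calc _ ≤ (1 / 100 + 1 / 100) * ((I.lam - eig I.A 0) * 1) := by gcongr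
    _ ≤ _ := by linarith

theorem expect_warmStep_le (x : Vec d) :
    (I.warmStep 100 x).expect (I.warmPotential v)
      ≤ ENNReal.ofReal (1 / 2) * I.warmPotential v x := by
  by_cases hx : x ∈ I.warmSet v
  swap
  · rw [Input.warmPotential, if_neg hx, ENNReal.mul_top (by simp)]
    exact le_top
  obtain ⟨z', hz'⟩ := h.exists_solution x
  have hb := h.shift_pos
  have hmu := h.mu_pos
  have hq0 := h.lowMode.energy_perp_nonneg x
  have hφx : I.warmPotential v x = ENNReal.ofReal (energy I.shiftLin (perp v x)) := if_pos hx
  have hE := h.expect_solve_le (K := 100) (by norm_num) 100 hx.1 hz'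
  set b₁ := I.lam - eig I.A 0 with hb₁
  set q := energy I.shiftLin (perp v x) with hq
  simp only [Input.warmStep, Comp.expect_bind, Comp.expect_paid]
  have hpt : ∀ z : Vec d,
      (if decide (I.lamHat - (I.lam - I.lamHat) / 6 ≤ I.quot z ∧
          2 / 3 * (1 / (I.lam - I.lamHat)) ≤ ‖z‖) = true
        then Input.normalize z else pure x : Comp (Vec d)).expect (I.warmPotential v)
      ≤ ENNReal.ofReal (1 / 2000 * q)
        + ENNReal.ofReal (100 * b₁ ^ 2) * ENNReal.ofReal (energy I.shiftLin (z - z')) := by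
    intro z
    have he0 := h.lowMode.energy_nonneg (z - z')
    rw [← ENNReal.ofReal_mul (by positivity), ← ENNReal.ofReal_add (by positivity)
      (by positivity)]
    by_cases hacc : I.lamHat - (I.lam - I.lamHat) / 6 ≤ I.quot z ∧
        2 / 3 * (1 / (I.lam - I.lamHat)) ≤ ‖z‖
    · rw [if_pos (by simpa using hacc), Input.normalize, Comp.expect_paid]
      obtain ⟨h1, h2⟩ := hacc
      change 2 / 3 * (1 / I.mu) ≤ ‖z‖ at h2
      have hn : 0 < ‖z‖ := lt_of_lt_of_le (by positivity) h2
      have hz0 : z ≠ 0 := norm_pos_iff.1 hn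
      have h3 := h.lowMode.warm_of_energy_le h.mu_le hz0 ((I.quot_iff hz0).1 h1)
      have hmem : (1 / ‖z‖) • z ∈ I.warmSet v :=
        ⟨by rw [norm_smul, norm_div, norm_one, norm_norm, one_div_mul_cancel hn.ne'], h3⟩
      rw [Input.warmPotential, if_pos hmem]
      refine ENNReal.ofReal_le_ofReal ?_
      have h4 := h.lowMode.energy_perp_inexact_le (z := z) hz'
      rw [← hb₁, ← hq] at h4
      have h5 : 1 / ‖z‖ ≤ 3 / 2 * b₁ := by
        rw [div_le_iff₀ hn]
        have h6 : 3 / 2 * I.mu * (2 / 3 * (1 / I.mu)) ≤ 3 / 2 * I.mu * ‖z‖ := by gcongr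
        have h7 : 3 / 2 * I.mu * (2 / 3 * (1 / I.mu)) = 1 := by field_simp
        have h8 : 3 / 2 * I.mu * ‖z‖ ≤ 3 / 2 * b₁ * ‖z‖ := by gcongr; exact h.mu_le
        linarith
      rw [perp_smul, energy_smul]
      calc _ ≤ (3 / 2 * b₁) ^ 2 * (q / (5000 * b₁ ^ 2) + 2 * energy I.shiftLin (z - z')) := by
            have := h.lowMode.energy_perp_nonneg z
            gcongr
        _ = 9 / 20000 * q + 9 / 2 * b₁ ^ 2 * energy I.shiftLin (z - z') := by field_simp; ring
        _ ≤ _ := by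
            have : 0 ≤ b₁ ^ 2 * energy I.shiftLin (z - z') := by positivity
            linarith
    · rw [if_neg (by simpa using hacc), Comp.expect_pure, hφx]
      refine ENNReal.ofReal_le_ofReal ?_
      have h1 : 1 / (500 * b₁) < energy I.shiftLin (z - z') := by
        by_contra! hle
        refine hacc ?_
        obtain ⟨h2, h3⟩ := h.lowMode.warm_accept hz' hx.1 hx.2 h.le_mu hle
        have hz0 : z ≠ 0 := norm_pos_iff.1 (lt_of_lt_of_le (by positivity) h3)
        exact ⟨(I.quot_iff hz0).2 h2, h3⟩
      rw [div_lt_iff₀ (by positivity)] at h1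
      have h2 : q ≤ 17 / 100 * b₁ := hx.2
      calc q ≤ 17 / 100 * b₁ * 1 := by linarith
        _ ≤ 17 / 100 * b₁ * (energy I.shiftLin (z - z') * (500 * b₁)) := by gcongr
        _ ≤ _ := by
          have : 0 ≤ b₁ ^ 2 * energy I.shiftLin (z - z') := by positivity
          nlinarith
  refine (Comp.expect_mono _ hpt).trans ?_
  rw [Comp.expect_add, Comp.expect_const, Comp.expect_const_mul, hφx]
  refine (add_le_add_right (mul_le_mul_right hE _) _).trans ?_
  have hr0 := solveRate_nonneg 100
  rw [← ENNReal.ofReal_mul (by positivity), ← ENNReal.ofReal_mul (by positivity),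
    ← ENNReal.ofReal_add (by positivity) (by positivity)]
  refine ENNReal.ofReal_le_ofReal ?_
  have hr : solveRate 100 ^ 100 ≤ 1 / 10000 :=
    (pow_le_of_le_one hr0 (solveRate_hundred_le.trans (by norm_num)) (by norm_num)).trans
      solveRate_hundred_le
  calc _ = 1 / 2000 * q + 100 * (solveRate 100 ^ 100 * q) := by field_simp
    _ ≤ 1 / 2000 * q + 100 * (1 / 10000 * q) := by gcongr
    _ ≤ _ := by linarith

/-- The failure probability of the main phase from a warm start. -/
theorem failProb_warm_le {ε : ℝ} (hε : 0 < ε) (T : ℕ) {x : Vec d} (hx : x ∈ I.warmSet v) :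
    (Comp.loop (I.warmStep 100) T x).failProb {x | ‖x‖ = 1 ∧ 1 - ε ≤ |(inner ℝ v x : ℝ)|}
      ≤ ENNReal.ofReal ((1 / 2) ^ T / ε) := by
  have hb := h.shift_pos
  set b₁ := I.lam - eig I.A 0 with hb₁
  have h1 := Comp.mul_failProb_le (Comp.loop (I.warmStep 100) T x)
    (S := {x | ‖x‖ = 1 ∧ 1 - ε ≤ |(inner ℝ v x : ℝ)|}) (φ := I.warmPotential v)
    (t := ENNReal.ofReal (100 * b₁ * ε)) (fun y hy => by
      rw [Input.warmPotential]
      split_ifs with hw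
      · refine ENNReal.ofReal_le_ofReal ?_
        have h2 : |(inner ℝ v y : ℝ)| < 1 - ε := by
          by_contra! hle
          exact hy ⟨hw.1, hle⟩
        have h3 := norm_sq_eq_add_perp h.norm_eq y
        rw [hw.1, one_pow, ← sq_abs (inner ℝ v y : ℝ)] at h3
        have h4 := abs_nonneg (inner ℝ v y : ℝ)
        have h5 : ε ≤ ‖perp v y‖ ^ 2 := by nlinarith
        calc 100 * b₁ * ε ≤ 100 * b₁ * ‖perp v y‖ ^ 2 := by gcongr
          _ ≤ _ := h.lowMode.norm_perp_le y
      · exact le_top)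
  have h2 := h1.trans (Comp.expect_loop_le h.expect_warmStep_le T x)
  have hφx : I.warmPotential v x = ENNReal.ofReal (energy I.shiftLin (perp v x)) := if_pos hx
  rw [hφx, ← ENNReal.ofReal_pow (by norm_num), ← ENNReal.ofReal_mul (by positivity)] at h2
  have h3 : (Comp.loop (I.warmStep 100) T x).failProb
      {x | ‖x‖ = 1 ∧ 1 - ε ≤ |(inner ℝ v x : ℝ)|}
      ≤ ENNReal.ofReal ((1 / 2) ^ T * energy I.shiftLin (perp v x) / (100 * b₁ * ε)) := by
    rwa [ENNReal.ofReal_div_of_pos (by positivity), ENNReal.le_div_iff_mul_le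
      (Or.inl (by simp; positivity)) (Or.inl ENNReal.ofReal_ne_top), mul_comm]
  refine h3.trans (ENNReal.ofReal_le_ofReal ?_)
  rw [div_le_div_iff₀ (by positivity) hε]
  have h4 : energy I.shiftLin (perp v x) ≤ 100 * b₁ := by
    have := hx.2
    rw [← hb₁] at this
    linarith
  calc _ ≤ (1 / 2) ^ T * (100 * b₁) * ε := by gcongr
    _ = _ := by ring

/-- The failure probability of the method from a given Gaussian vector. -/
theorem failProb_powerMethod_le {g : Vec d} {Q : ℝ} (hQ : 0 ≤ Q) (hε : 0 < I.eps)
    (hc : (inner ℝ v g : ℝ) ≠ 0)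
    (hg : energy I.shiftLin (perp v g) ≤ Q * ((I.lam - eig I.A 0) * (inner ℝ v g : ℝ) ^ 2))
    (hcount : Q / 2 ^ I.burnInCount 100 ≤ 1 / 100) :
    (I.powerMethod 100 g).failProb {x | ‖x‖ = 1 ∧ 1 - I.eps ≤ |(inner ℝ v x : ℝ)|}
      ≤ ENNReal.ofReal (I.burnInCount 100
          * (10000 * (solveRate 100 ^ I.burnInCount 100 * (Q + 1)))
        + (1 / 2) ^ ⌈(100 : ℕ) * Real.log (d / I.eps)⌉₊ / I.eps) := by
  have hb := h.shift_pos
  have h0 : (1 / ‖g‖) • g ∈ I.burnInSet v Q 0 := by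
    refine I.normalize_mem_burnInSet hc (hg.trans ?_)
    gcongr
    simp
  have hburn := Comp.failProb_loop_le (f := I.burnInStep 100) (S := I.burnInSet v Q)
    (fun k x hx => h.failProb_burnInStep_le (by norm_num) hQ k hx) (I.burnInCount 100) 0 h0
  rw [zero_add] at hburn
  have hwarm := Comp.failProb_bind_le _ (Comp.loop (I.warmStep 100)
      ⌈(100 : ℕ) * Real.log (d / I.eps)⌉₊) hburn
    (fun x hx => h.failProb_warm_le hε _ (h.burnInSet_subset_warmSet hcount hx))
  have hr0 := solveRate_nonneg 100
  rw [ENNReal.ofReal_add (by positivity) (by positivity), ENNReal.ofReal_mul (by positivity),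
    ENNReal.ofReal_natCast]
  refine le_trans (le_of_eq ?_) hwarm
  simp only [Comp.failProb, Input.powerMethod, Input.normalize, Comp.expect_bind,
    Comp.expect_paid]

end Regime

section Gaussian

open MeasureTheory ProbabilityTheory

theorem gaussianReal_small_ball_le (t : ℝ) :
    gaussianReal 0 1 {x | |x| < t} ≤ ENNReal.ofReal t := by
  have hset : {x : ℝ | |x| < t} = Set.Ioo (-t) t := by
    ext x; simp [abs_lt]
  have hpdf : ∀ x, gaussianPDF 0 1 x ≤ ENNReal.ofReal (1 / 2) := fun x => by
    rw [gaussianPDF]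
    refine ENNReal.ofReal_le_ofReal ?_
    rw [gaussianPDFReal]
    have h1 : 2 ≤ √(2 * Real.pi * ((1 : NNReal) : ℝ)) := by
      refine Real.le_sqrt_of_sq_le ?_
      have := Real.pi_gt_three
      norm_num
      linarith
    have h2 : Real.exp (-(x - 0) ^ 2 / (2 * ((1 : NNReal) : ℝ))) ≤ 1 := by
      refine Real.exp_le_one_iff.2 ?_
      have : 0 ≤ x ^ 2 := sq_nonneg x
      simp only [sub_zero, NNReal.coe_one, mul_one]
      linarith
    calc _ ≤ (2 : ℝ)⁻¹ * 1 := by gcongr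
      _ = 1 / 2 := by norm_num
  rw [gaussianReal_of_var_ne_zero _ one_ne_zero, hset, withDensity_apply _ measurableSet_Ioo]
  calc _ ≤ ∫⁻ _ in Set.Ioo (-t) t, ENNReal.ofReal (1 / 2) := lintegral_mono hpdf
    _ = ENNReal.ofReal t := by
      rw [lintegral_const, Measure.restrict_apply_univ, Real.volume_Ioo,
        ← ENNReal.ofReal_mul (by norm_num)]
      congr 1; ring

variable {d : ℕ}

theorem map_inner_stdGaussian {v : Vec d} (hv : ‖v‖ = 1) :
    (stdGaussian (Vec d)).map (innerSL ℝ v) = gaussianReal 0 1 := by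
  rw [IsGaussian.map_eq_gaussianReal, integral_strongDual_stdGaussian, variance_dual_stdGaussian,
    innerSL_apply_norm, hv]
  simp

theorem stdGaussian_inner_small_le {v : Vec d} (hv : ‖v‖ = 1) (t : ℝ) :
    stdGaussian (Vec d) {g | |(inner ℝ v g : ℝ)| < t} ≤ ENNReal.ofReal t := by
  have hm : MeasurableSet {x : ℝ | |x| < t} := measurableSet_lt (by fun_prop) (by fun_prop)
  refine le_trans (le_of_eq ?_) (gaussianReal_small_ball_le t)
  rw [← map_inner_stdGaussian hv, Measure.map_apply (by fun_prop) hm]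
  rfl

theorem stdGaussian_inner_large_le {v : Vec d} (hv : ‖v‖ = 1) {t : ℝ} (ht : 0 < t) :
    stdGaussian (Vec d) {g | t ≤ |(inner ℝ v g : ℝ)|} ≤ ENNReal.ofReal (1 / t ^ 2) := by
  have h := meas_ge_le_variance_div_sq (μ := stdGaussian (Vec d))
    (X := innerSL ℝ v) (IsGaussian.memLp_dual _ _ 2 (by simp)) ht
  rw [variance_dual_stdGaussian, innerSL_apply_norm, hv, one_pow] at h
  refine le_trans (le_of_eq ?_) h
  rw [integral_strongDual_stdGaussian]
  simp

/-- The Gaussian vectors of moderate length that are not almost orthogonal to `v`. -/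
def typicalSet (v : Vec d) : Set (Vec d) :=
  {g | ‖g‖ ^ 2 ≤ (d : ℝ) ^ 13 ∧ 1 / (d : ℝ) ^ 10 ≤ |(inner ℝ v g : ℝ)|}

theorem measurableSet_typicalSet (v : Vec d) : MeasurableSet (typicalSet v) := by
  have h1 : MeasurableSet {g : Vec d | ‖g‖ ^ 2 ≤ (d : ℝ) ^ 13} :=
    measurableSet_le (by fun_prop) (by fun_prop)
  have h2 : MeasurableSet {g : Vec d | 1 / (d : ℝ) ^ 10 ≤ |(inner ℝ v g : ℝ)|} :=
    measurableSet_le (by fun_prop) (by fun_prop)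
  exact h1.inter h2

theorem stdGaussian_compl_typicalSet_le (hd : 0 < d) {v : Vec d} (hv : ‖v‖ = 1) :
    stdGaussian (Vec d) (typicalSet v)ᶜ ≤ ENNReal.ofReal (2 / (d : ℝ) ^ 10) := by
  have hd' : (1 : ℝ) ≤ d := by exact_mod_cast hd
  have hsub : (typicalSet v)ᶜ ⊆ (⋃ i : Fin d, {g : Vec d |
      (d : ℝ) ^ 6 ≤ |(inner ℝ (EuclideanSpace.single i (1 : ℝ)) g : ℝ)|})
      ∪ {g | |(inner ℝ v g : ℝ)| < 1 / (d : ℝ) ^ 10} := by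
    intro g hg
    by_contra hcon
    simp only [Set.mem_union, Set.mem_iUnion, Set.mem_ofPred_eq, not_or, not_exists, not_le,
      not_lt] at hcon
    refine hg ⟨?_, hcon.2⟩
    rw [EuclideanSpace.norm_sq_eq]
    calc ∑ i, ‖g i‖ ^ 2 ≤ ∑ _i : Fin d, ((d : ℝ) ^ 6) ^ 2 := by
          refine Finset.sum_le_sum fun i _ => ?_
          have := (hcon.1 i).le
          rw [EuclideanSpace.inner_single_left] at this
          simp only [map_one, one_mul] at this
          rw [Real.norm_eq_abs]
          gcongr
      _ = (d : ℝ) ^ 13 := by simp; ring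
  refine (measure_mono hsub).trans ((measure_union_le _ _).trans ?_)
  have h1 : stdGaussian (Vec d) (⋃ i : Fin d, {g : Vec d |
      (d : ℝ) ^ 6 ≤ |(inner ℝ (EuclideanSpace.single i (1 : ℝ)) g : ℝ)|})
      ≤ ENNReal.ofReal (1 / (d : ℝ) ^ 10) := by
    refine (measure_iUnion_fintype_le _ _).trans ?_
    calc _ ≤ ∑ _i : Fin d, ENNReal.ofReal (1 / ((d : ℝ) ^ 6) ^ 2) :=
          Finset.sum_le_sum fun i _ => stdGaussian_inner_large_le (by simp) (by positivity)
      _ = ENNReal.ofReal (d * (1 / ((d : ℝ) ^ 6) ^ 2)) := by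
          rw [Finset.sum_const, Finset.card_univ, Fintype.card_fin, nsmul_eq_mul,
            ENNReal.ofReal_mul (by positivity), ENNReal.ofReal_natCast]
      _ ≤ _ := by
          refine ENNReal.ofReal_le_ofReal ?_
          calc (d : ℝ) * (1 / ((d : ℝ) ^ 6) ^ 2) = 1 / (d : ℝ) ^ 11 := by field_simp
            _ ≤ _ := by gcongr; norm_num
  have h2 := stdGaussian_inner_small_le hv (1 / (d : ℝ) ^ 10)
  refine (add_le_add h1 h2).trans (le_of_eq ?_)
  rw [← ENNReal.ofReal_add (by positivity) (by positivity)]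
  congr 1; ring

end Gaussian

theorem exp_mul_log_pow {a x : ℝ} (hx : 0 < x) (k : ℕ) (ha : (k : ℝ) ≤ a) (hx1 : 1 ≤ x) :
    x ^ k ≤ Real.exp (a * Real.log x) := by
  calc x ^ k = Real.exp (k * Real.log x) := by rw [Real.exp_nat_mul, Real.exp_log hx]
    _ ≤ _ := by
      have := Real.log_nonneg hx1
      gcongr

theorem pow_le_exp_ceil {x : ℝ} (hx1 : 1 ≤ x) (k : ℕ) :
    x ^ k ≤ Real.exp 1 ^ ⌈k * Real.log x⌉₊ := by
  rw [← Real.exp_nat_mul, mul_one]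
  refine (exp_mul_log_pow (by linarith) k le_rfl hx1).trans ?_
  exact Real.exp_le_exp.2 (Nat.le_ceil _)

theorem pow_le_two_pow_ceil {x : ℝ} (hx1 : 1 ≤ x) :
    x ^ 60 ≤ 2 ^ ⌈(100 : ℕ) * Real.log x⌉₊ := by
  have h2 : Real.exp (6 / 10) ≤ 2 := by
    have := Real.log_two_gt_d9
    calc Real.exp (6 / 10) ≤ Real.exp (Real.log 2) := by gcongr; linarith
      _ = 2 := Real.exp_log (by norm_num)
  calc x ^ 60 ≤ Real.exp (60 * Real.log x) :=
        exp_mul_log_pow (by linarith) 60 (by norm_num) hx1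
    _ = Real.exp (6 / 10 * ((100 : ℕ) * Real.log x)) := by push_cast; ring_nf
    _ ≤ Real.exp (6 / 10 * ⌈(100 : ℕ) * Real.log x⌉₊) := by
        gcongr; exact Nat.le_ceil _
    _ = Real.exp (6 / 10) ^ ⌈(100 : ℕ) * Real.log x⌉₊ := by
        rw [← Real.exp_nat_mul]; ring_nf
    _ ≤ _ := by gcongr

namespace Regime

variable {n d : ℕ} {I : Input n d} {v : Vec d} (h : Regime I v)
include h

theorem gapHat_le : I.gapHat ≤ gap I.A := by
  rw [Input.gapHat, div_le_iff₀ h.lamHat_pos]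
  have h1 := h.mu_le
  rw [Input.mu] at h1
  have h2 := mul_le_mul_of_nonneg_left h.eig_le_lamHat h.gap_pos.le
  linarith [h.shift_le]

theorem le_gapHat : gap I.A / 2 ≤ I.gapHat := by
  rw [Input.gapHat, le_div_iff₀ h.lamHat_pos]
  have h1 := h.le_mu
  rw [Input.mu] at h1
  have h2 := mul_le_mul_of_nonneg_left h.lamHat_le h.gap_pos.le
  linarith [h.le_shift, h.gap_mul_pos]

theorem gapHat_pos : 0 < I.gapHat := lt_of_lt_of_le (half_pos h.gap_pos) h.le_gapHat

theorem two_le' : (2 : ℝ) ≤ d := by exact_mod_cast h.two_le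

theorem le_div_gapHat : d ≤ d / I.gapHat := by
  rw [le_div_iff₀ h.gapHat_pos]
  exact mul_le_of_le_one_right h.d_pos.le (h.gapHat_le.trans h.gap_le_one)

theorem energy_perp_le_of_typical {g : Vec d} (hg : g ∈ typicalSet v) :
    energy I.shiftLin (perp v g)
      ≤ (d / I.gapHat) ^ 41 * ((I.lam - eig I.A 0) * (inner ℝ v g : ℝ) ^ 2) := by
  obtain ⟨hg1, hg2⟩ := hg
  have hd := h.d_pos
  have hgap := h.gap_pos
  have hgh := h.gapHat_pos
  have hb := h.shift_pos
  have hD : 2 ≤ d / I.gapHat := h.two_le'.trans h.le_div_gapHat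
  set D := d / I.gapHat
  have hDg : d / gap I.A ≤ D := by
    simp only [D]; gcongr; exact h.gapHat_le
  have h1 : energy I.shiftLin (perp v g) ≤ I.lam * ‖g‖ ^ 2 := by
    refine (h.lowMode.energy_perp_le g).trans ?_
    rw [Input.energy_shiftLin]
    linarith [energy_gramLin_nonneg I.A g]
  have h2 : I.lam * gap I.A ≤ 152 * (I.lam - eig I.A 0) := by
    have h3 := h.le_shift
    have h4 : I.lam ≤ 101 / 100 * eig I.A 0 := by linarith [h.shift_le, h.gap_mul_le]
    have h5 := mul_le_mul_of_nonneg_right h4 hgap.le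
    linarith
  have h6 : (1 : ℝ) ≤ (d : ℝ) ^ 20 * (inner ℝ v g : ℝ) ^ 2 := by
    rw [div_le_iff₀ (by positivity)] at hg2
    calc (1 : ℝ) = 1 ^ 2 := by norm_num
      _ ≤ (|(inner ℝ v g : ℝ)| * (d : ℝ) ^ 10) ^ 2 := by gcongr
      _ = _ := by rw [mul_pow, sq_abs]; ring
  have h7 : I.lam ≤ 152 * (I.lam - eig I.A 0) / gap I.A := by rwa [le_div_iff₀ hgap]
  have hlam : 0 ≤ I.lam := by linarith [h.eig_pos]
  calc _ ≤ I.lam * ‖g‖ ^ 2 := h1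
    _ ≤ 152 * (I.lam - eig I.A 0) / gap I.A * (d : ℝ) ^ 13 * 1 := by rw [mul_one]; gcongr
    _ ≤ 152 * (I.lam - eig I.A 0) / gap I.A * (d : ℝ) ^ 13
        * ((d : ℝ) ^ 20 * (inner ℝ v g : ℝ) ^ 2) := by gcongr
    _ = 152 * (d : ℝ) ^ 32 * (d / gap I.A)
        * ((I.lam - eig I.A 0) * (inner ℝ v g : ℝ) ^ 2) := by ring
    _ ≤ D ^ 8 * D ^ 32 * D * ((I.lam - eig I.A 0) * (inner ℝ v g : ℝ) ^ 2) := by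
        gcongr
        · calc (152 : ℝ) ≤ 2 ^ 8 := by norm_num
            _ ≤ _ := by gcongr
        · exact h.le_div_gapHat
    _ = _ := by ring

theorem failProb_of_typical {g : Vec d} (hε : 0 < I.eps) (hε1 : I.eps < 1)
    (hg : g ∈ typicalSet v) :
    (I.powerMethod 100 g).failProb {x | ‖x‖ = 1 ∧ 1 - I.eps ≤ |(inner ℝ v x : ℝ)|}
      ≤ ENNReal.ofReal (20001 / (d : ℝ) ^ 10) := by
  have hd := h.d_pos
  have hd2 := h.two_le'
  have hD : 2 ≤ d / I.gapHat := h.two_le'.trans h.le_div_gapHat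
  have hdD := h.le_div_gapHat
  have hen := h.energy_perp_le_of_typical hg
  have hN2 : (d / I.gapHat) ^ 60 ≤ 2 ^ I.burnInCount 100 := pow_le_two_pow_ceil (by linarith)
  have hNe : (d / I.gapHat) ^ 100 ≤ Real.exp 1 ^ I.burnInCount 100 :=
    pow_le_exp_ceil (by linarith) 100
  set N := I.burnInCount 100
  set D := d / I.gapHat
  have hD0 : 0 < D := by linarith
  have hc : (inner ℝ v g : ℝ) ≠ 0 := by
    intro h0
    have := hg.2
    rw [h0, abs_zero] at this
    have : 0 < 1 / (d : ℝ) ^ 10 := by positivity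
    linarith
  have hcount : D ^ 41 / 2 ^ N ≤ 1 / 100 := by
    rw [div_le_div_iff₀ (by positivity) (by norm_num)]
    calc D ^ 41 * 100 ≤ D ^ 41 * 2 ^ 19 := by gcongr; norm_num
      _ ≤ D ^ 41 * D ^ 19 := by gcongr
      _ = D ^ 60 := by ring
      _ ≤ _ := by linarith
  refine (h.failProb_powerMethod_le (by positivity) hε hc hen hcount).trans ?_
  refine ENNReal.ofReal_le_ofReal ?_
  have hr0 := solveRate_nonneg 100
  have h1 : (N : ℝ) * solveRate 100 ^ N ≤ 1 / D ^ 100 :=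
    calc (N : ℝ) * solveRate 100 ^ N ≤ 2 ^ N * solveRate 100 ^ N := by
          gcongr; exact_mod_cast Nat.lt_two_pow_self.le
      _ = (2 * solveRate 100) ^ N := by rw [mul_pow]
      _ ≤ (1 / Real.exp 1) ^ N := by
          gcongr
          rw [le_div_iff₀ (Real.exp_pos _)]
          have := Real.exp_one_lt_d9
          have h3 := solveRate_hundred_le
          nlinarith
      _ = 1 / Real.exp 1 ^ N := by rw [div_pow, one_pow]
      _ ≤ _ := by gcongr
  have h2 : N * (10000 * (solveRate 100 ^ N * (D ^ 41 + 1))) ≤ 20000 / (d : ℝ) ^ 10 :=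
    calc _ = 10000 * (N * solveRate 100 ^ N) * (D ^ 41 + 1) := by ring
      _ ≤ 10000 * (1 / D ^ 100) * (D ^ 41 + D ^ 41) := by
          gcongr; exact one_le_pow₀ (by linarith)
      _ = 20000 / D ^ 59 := by field_simp; norm_num
      _ ≤ 20000 / D ^ 10 := by gcongr <;> [linarith; norm_num]
      _ ≤ _ := by gcongr
  have h3 : (1 / 2) ^ ⌈(100 : ℕ) * Real.log (d / I.eps)⌉₊ / I.eps ≤ 1 / (d : ℝ) ^ 10 := by
    have hx : 1 ≤ d / I.eps := by rw [le_div_iff₀ hε]; linarith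
    have h4 := pow_le_two_pow_ceil hx
    rw [div_pow, one_pow, div_div, div_le_div_iff₀ (by positivity) (by positivity), one_mul,
      one_mul]
    calc (d : ℝ) ^ 10 ≤ (d : ℝ) ^ 11 / I.eps ^ 10 := by
          rw [le_div_iff₀ (by positivity)]
          calc (d : ℝ) ^ 10 * I.eps ^ 10 ≤ (d : ℝ) ^ 10 * 1 := by
                gcongr; exact pow_le_one₀ hε.le hε1.le
            _ ≤ (d : ℝ) ^ 10 * d := by gcongr; linarith
            _ = _ := by ring
      _ = (d / I.eps) ^ 11 * I.eps := by field_simp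
      _ ≤ (d / I.eps) ^ 60 * I.eps := by gcongr; norm_num
      _ ≤ _ := by gcongr
  calc _ ≤ 20000 / (d : ℝ) ^ 10 + 1 / (d : ℝ) ^ 10 := add_le_add h2 h3
    _ = _ := by ring

/-- The success probability of the method. -/
theorem le_successProb (hε : 0 < I.eps) (hε1 : I.eps < 1) :
    1 - ENNReal.ofReal (20003 / (d : ℝ) ^ 10)
      ≤ I.successProb 100 {x | ‖x‖ = 1 ∧ 1 - I.eps ≤ |(inner ℝ v x : ℝ)|} := by
  have hd := h.d_pos
  set S : Set (Vec d) := {x | ‖x‖ = 1 ∧ 1 - I.eps ≤ |(inner ℝ v x : ℝ)|}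
  set δ := ENNReal.ofReal (20001 / (d : ℝ) ^ 10)
  have hpt : ∀ g, 1 ≤ (I.powerMethod 100 g).prob S + (δ + (typicalSet v)ᶜ.indicator 1 g) := by
    intro g
    by_cases hg : g ∈ typicalSet v
    · have h1 := Comp.one_sub_failProb_le (I.powerMethod 100 g) S
      rw [tsub_le_iff_right] at h1
      refine h1.trans ?_
      gcongr
      exact (h.failProb_of_typical hε hε1 hg).trans le_self_add
    · rw [Set.indicator_of_mem (by exact hg), Pi.one_apply, ← add_assoc]
      exact le_add_self
  have hm : Measurable fun g => δ + (typicalSet v)ᶜ.indicator (1 : Vec d → ℝ≥0∞) g :=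
    Measurable.const_add (measurable_one.indicator (measurableSet_typicalSet v).compl) δ
  have hint := MeasureTheory.lintegral_mono (μ := ProbabilityTheory.stdGaussian (Vec d)) hpt
  rw [MeasureTheory.lintegral_add_right _ hm, MeasureTheory.lintegral_add_left measurable_const,
    MeasureTheory.lintegral_indicator_one (measurableSet_typicalSet v).compl] at hint
  simp only [MeasureTheory.lintegral_const, MeasureTheory.measure_univ, mul_one] at hint
  rw [tsub_le_iff_right]
  refine hint.trans (add_le_add le_rfl ?_)
  refine (add_le_add le_rfl (stdGaussian_compl_typicalSet_le (by exact_mod_cast hd)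
    h.norm_eq)).trans (le_of_eq ?_)
  rw [← ENNReal.ofReal_add (by positivity) (by positivity)]
  congr 1; ring

end Regime

theorem rowNnz_le {n d : ℕ} (A : Matrix (Fin n) (Fin d) ℝ) (i : Fin n) : rowNnz A i ≤ d := by
  refine (Finset.card_filter_le _ _).trans ?_
  simp

theorem ceil_mul_le {a b x : ℝ} (hx : 0 ≤ a * x) (hb : 1 ≤ b * x) :
    (⌈a * x⌉₊ : ℝ) ≤ (a + b) * x := by
  have := Nat.ceil_lt_add_one hx
  linarith

namespace Input

variable {n d : ℕ} (I : Input n d)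

theorem costLE_svrgStep (b y w g x : Vec d) : (I.svrgStep b y w g x).CostLE (25 * d + 13) := by
  have hpsi : ∀ (i : Fin n) (z : Vec d),
      (Comp.paid (4 * rowNnz I.A i + 6 * d + 5) z).CostLE (10 * d + 5) := fun i z => by
    refine (Comp.costLE_paid _ _).mono ?_
    have : (rowNnz I.A i : ℝ) ≤ d := by exact_mod_cast rowNnz_le I.A i
    push_cast
    linarith
  refine Comp.CostLE.mono ((Comp.costLE_draw _).bind fun i => (hpsi i _).bind fun s =>
    (hpsi i _).bind fun t => Comp.costLE_paid _ _) ?_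
  push_cast
  linarith

theorem costLE_svrgEpoch (b y w : Vec d) : (I.svrgEpoch b y w).CostLE
    (4 * nnz I.A + 6 * d + 1 + (I.epochMax + 1) * (25 * d + 14)) := by
  have hloop : ∀ (g : Vec d) (k : Fin (I.epochMax + 1)),
      (Comp.loop (I.svrgStep b y w g) (k.val + 1) w).CostLE
        ((I.epochMax + 1) * (25 * d + 14)) := fun g k => by
    refine (Comp.CostLE.loop (I.costLE_svrgStep b y w g) _ w).mono ?_
    have : ((k.val + 1 : ℕ) : ℝ) ≤ I.epochMax + 1 := by exact_mod_cast k.is_lt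
    calc _ ≤ (I.epochMax + 1 : ℝ) * (25 * d + 13 + 1) := by gcongr
      _ = _ := by ring
  refine Comp.CostLE.mono ((Comp.costLE_paid _ _).bind fun g => (Comp.costLE_draw _).bind
    fun k => hloop g k) ?_
  push_cast
  linarith

theorem costLE_proxStep {K : ℕ} {c : ℝ} (hc : ∀ b y w, (I.svrgEpoch b y w).CostLE c)
    (b y : Vec d) : (I.proxStep K b y).CostLE (⌈K * Real.log I.rho⌉₊ * (c + 1)) :=
  Comp.CostLE.loop (hc b y) _ y

theorem costLE_accelStep {K : ℕ} {c : ℝ} (hc : ∀ b y, (I.proxStep K b y).CostLE c)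
    (b : Vec d) (s : Vec d × Vec d) : (I.accelStep K b s).CostLE (c + 10 * d + 11) := by
  refine Comp.CostLE.mono ((Comp.costLE_paid _ _).bind fun α => (Comp.costLE_paid _ _).bind
    fun y => (hc b y).bind fun x => (Comp.costLE_paid _ _).bind fun g =>
    (Comp.costLE_paid _ _).bind fun w => Comp.costLE_pure _) ?_
  push_cast
  linarith

theorem costLE_accelSolve {K : ℕ} {c : ℝ} (hc : ∀ b s, (I.accelStep K b s).CostLE c)
    (b z : Vec d) : (I.accelSolve K b z).CostLE (⌈K * √I.rho⌉₊ * (c + 1)) := by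
  refine Comp.CostLE.mono ((Comp.CostLE.loop (hc b) _ (z, z)).bind fun s =>
    Comp.costLE_pure _) ?_
  linarith

theorem costLE_solve {K : ℕ} {c : ℝ} (hc : ∀ b z, (I.accelSolve K b z).CostLE c) (r : ℕ)
    (x : Vec d) : (I.solve K r x).CostLE (4 * nnz I.A + 5 * d + 1 + r * (c + 1)) := by
  refine Comp.CostLE.mono ((Comp.costLE_paid _ _).bind fun z =>
    Comp.CostLE.loop (hc x) r z) ?_
  push_cast
  linarith

theorem costLE_normalize (z : Vec d) : (normalize z).CostLE (3 * d + 2) := by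
  refine (Comp.costLE_paid _ _).mono ?_
  push_cast
  linarith

theorem costLE_burnInStep {K : ℕ} {c : ℝ} (hc : ∀ x, (I.solve K (I.burnInCount K) x).CostLE c)
    (x : Vec d) : (I.burnInStep K x).CostLE (c + (3 * d + 2)) :=
  (hc x).bind costLE_normalize

theorem costLE_warmStep {K : ℕ} {c : ℝ} (hc : ∀ x, (I.solve K K x).CostLE c) (x : Vec d) :
    (I.warmStep K x).CostLE (c + 4 * nnz I.A + 7 * d + 12) := by
  refine Comp.CostLE.mono ((hc x).bind (c' := 4 * nnz I.A + 7 * d + 12) fun z =>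
    Comp.CostLE.mono ((Comp.costLE_paid _ _).bind (c' := 3 * d + 2) fun accept => ?_) ?_) ?_
  · split_ifs
    · exact costLE_normalize z
    · exact (Comp.costLE_pure x).mono (by positivity)
  · push_cast
    linarith
  · linarith

theorem costLE_powerMethod {K : ℕ} {c c' : ℝ} (hc : ∀ x, (I.burnInStep K x).CostLE c)
    (hc' : ∀ x, (I.warmStep K x).CostLE c') (g : Vec d) :
    (I.powerMethod K g).CostLE (10 * nnz I.A + 4 * d + 102 + I.burnInCount K * (c + 1)
      + ⌈K * Real.log (d / I.eps)⌉₊ * (c' + 1)) := by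
  refine Comp.CostLE.mono ((Comp.costLE_paid _ _).bind fun _ => (Comp.costLE_paid _ _).bind
    fun g => (costLE_normalize g).bind fun x => (Comp.CostLE.loop hc _ x).bind fun x =>
    Comp.CostLE.loop hc' _ x) ?_
  push_cast
  linarith

end Input

namespace Regime

variable {n d : ℕ} {I : Input n d} {v : Vec d} (h : Regime I v)
include h

theorem epochMax_mul_le : (I.epochMax + 1 : ℝ) * d ≤ 417 * nnz I.A := by
  have hmu := h.mu_pos; have hga := h.gamma_pos; have hF := h.frobSq_pos
  have hLH := h.lamHat_pos; have hd := h.d_pos; have hnnz := h.nnz_pos; have hS := h.variance_pos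
  have h1 : (I.epochMax : ℝ) ≤ 64 * I.variance / (I.mu + I.gamma) :=
    Nat.floor_le (by positivity)
  have h2 : I.lamHat * frobSq I.A = I.gamma ^ 2 * nnz I.A / d := by
    rw [h.gamma_sq]; field_simp
  have h3 : 64 * I.variance / (I.mu + I.gamma) ≤ 32 + 384 * nnz I.A / d := by
    calc 64 * I.variance / (I.mu + I.gamma)
        = 32 * (I.gamma ^ 2 + 12 * (I.lamHat * frobSq I.A)) / (I.mu + I.gamma) ^ 2 := by
          rw [Input.variance]; field_simp; ring
      _ ≤ 32 * (I.gamma ^ 2 + 12 * (I.lamHat * frobSq I.A)) / I.gamma ^ 2 := by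
          gcongr; linarith
      _ = _ := by rw [h2]; field_simp; ring
  have h4 := h.d_le_nnz
  calc (I.epochMax + 1 : ℝ) * d ≤ (32 + 384 * nnz I.A / d + 1) * d := by
        gcongr; linarith
    _ = 33 * d + 384 * nnz I.A := by field_simp; ring
    _ ≤ _ := by linarith

theorem costLE_svrgEpoch (b y w : Vec d) : (I.svrgEpoch b y w).CostLE (17000 * nnz I.A) := by
  refine (I.costLE_svrgEpoch b y w).mono ?_
  have h1 := h.epochMax_mul_le
  have h2 := h.d_le_nnz
  have h3 := h.two_le'
  have h4 : (0 : ℝ) ≤ I.epochMax := by positivity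
  nlinarith

theorem one_le_log_rho : 1 ≤ Real.log I.rho := by
  rw [Real.le_log_iff_exp_le h.rho_pos]
  have := Real.exp_one_lt_d9
  linarith [h.rho_ge]

theorem one_le_sqrt_rho : 1 ≤ √I.rho := Real.one_le_sqrt.2 (by linarith [h.rho_ge])

theorem costLE_accelSolve (b z : Vec d) :
    (I.accelSolve 100 b z).CostLE (2 * 10 ^ 8 * (√I.rho * Real.log I.rho * nnz I.A)) := by
  have hl := h.one_le_log_rho
  have hs := h.one_le_sqrt_rho
  have hn := h.d_le_nnz
  have hd := h.two_le'
  have h1 : (⌈(100 : ℕ) * Real.log I.rho⌉₊ : ℝ) ≤ 101 * Real.log I.rho := by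
    refine (ceil_mul_le (b := 1) (by positivity) (by linarith)).trans (le_of_eq ?_)
    norm_num
  have h2 : (⌈(100 : ℕ) * √I.rho⌉₊ : ℝ) ≤ 101 * √I.rho := by
    refine (ceil_mul_le (b := 1) (by positivity) (by linarith)).trans (le_of_eq ?_)
    norm_num
  refine (I.costLE_accelSolve (I.costLE_accelStep (I.costLE_proxStep h.costLE_svrgEpoch))
    b z).mono ?_
  have h3 : (nnz I.A : ℝ) ≤ Real.log I.rho * nnz I.A := le_mul_of_one_le_left (by linarith) hl
  calc _ ≤ 101 * √I.rho * (101 * Real.log I.rho * (17000 * nnz I.A + 1 * nnz I.A)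
        + 10 * (Real.log I.rho * nnz I.A) + 6 * (Real.log I.rho * nnz I.A) + 1 * nnz I.A) := by
        gcongr
        · linarith
        · linarith
        · linarith
        · linarith
    _ ≤ 101 * √I.rho * (101 * Real.log I.rho * (17000 * nnz I.A + 1 * nnz I.A)
        + 10 * (Real.log I.rho * nnz I.A) + 6 * (Real.log I.rho * nnz I.A)
        + 1 * (Real.log I.rho * nnz I.A)) := by gcongr
    _ = (101 * (101 * 17001 + 17)) * (√I.rho * Real.log I.rho * nnz I.A) := by ring
    _ ≤ _ := mul_le_mul_of_nonneg_right (by norm_num) (by positivity)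

theorem nnz_le_work : (nnz I.A : ℝ) ≤ √I.rho * Real.log I.rho * nnz I.A := by
  refine le_mul_of_one_le_left h.nnz_pos.le ?_
  nlinarith [h.one_le_log_rho, h.one_le_sqrt_rho]

theorem costLE_solve (r : ℕ) (x : Vec d) : (I.solve 100 r x).CostLE
    ((r + 1) * (3 * 10 ^ 8 * (√I.rho * Real.log I.rho * nnz I.A))) := by
  refine (I.costLE_solve h.costLE_accelSolve r x).mono ?_
  have h1 := h.nnz_le_work
  have h2 := h.d_le_nnz
  have h3 := h.two_le'
  set W := √I.rho * Real.log I.rho * nnz I.A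
  have h4 : (0 : ℝ) ≤ r := by positivity
  have h5 : (r : ℝ) ≤ r * W := le_mul_of_one_le_right h4 (by linarith)
  nlinarith

theorem costLE_burnInStep (x : Vec d) : (I.burnInStep 100 x).CostLE
    ((I.burnInCount 100 + 1) * (4 * 10 ^ 8 * (√I.rho * Real.log I.rho * nnz I.A))) := by
  refine (I.costLE_burnInStep (h.costLE_solve _) x).mono ?_
  have h1 := h.nnz_le_work
  have h2 := h.d_le_nnz
  have h3 := h.two_le'
  set W := √I.rho * Real.log I.rho * nnz I.A
  have h4 : 0 ≤ (I.burnInCount 100 : ℝ) * W := mul_nonneg (by positivity) (by linarith)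
  nlinarith

theorem costLE_warmStep (x : Vec d) : (I.warmStep 100 x).CostLE
    (4 * 10 ^ 10 * (√I.rho * Real.log I.rho * nnz I.A)) := by
  refine (I.costLE_warmStep (h.costLE_solve _) x).mono ?_
  have h1 := h.nnz_le_work
  have h2 := h.d_le_nnz
  have h3 := h.two_le'
  set W := √I.rho * Real.log I.rho * nnz I.A
  push_cast
  linarith

theorem two_le_div_gap : 2 ≤ d / gap I.A := by
  rw [le_div_iff₀ h.gap_pos]
  have := h.gap_le_one
  have := h.two_le'
  linarith

theorem log_two_le_log : Real.log 2 ≤ Real.log (d / gap I.A) :=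
  Real.log_le_log (by norm_num) h.two_le_div_gap

theorem burnInCount_le : (I.burnInCount 100 : ℝ) ≤ 202 * Real.log (d / gap I.A) := by
  have hd := h.d_pos; have hg := h.gap_pos; have hgh := h.gapHat_pos
  have h2 := h.log_two_le_log
  have hlog2 := Real.log_two_gt_d9
  have h1 : Real.log (d / I.gapHat) ≤ 2 * Real.log (d / gap I.A) :=
    calc Real.log (d / I.gapHat) ≤ Real.log (2 * (d / gap I.A)) := by
          refine Real.log_le_log (by positivity) ?_
          calc d / I.gapHat ≤ d / (gap I.A / 2) := by gcongr; exact h.le_gapHat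
            _ = _ := by field_simp
      _ = Real.log 2 + Real.log (d / gap I.A) := Real.log_mul (by norm_num) (by positivity)
      _ ≤ _ := by linarith
  have h3 : (I.burnInCount 100 : ℝ) ≤ ⌈200 * Real.log (d / gap I.A)⌉₊ := by
    have : I.burnInCount 100 ≤ ⌈200 * Real.log (d / gap I.A)⌉₊ :=
      Nat.ceil_mono (by push_cast; linarith)
    exact_mod_cast this
  refine h3.trans ((ceil_mul_le (b := 2) (by linarith) (by linarith)).trans (le_of_eq ?_))
  norm_num

theorem mainCount_le (hε : 0 < I.eps) (hε1 : I.eps < 1) :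
    (⌈(100 : ℕ) * Real.log (d / I.eps)⌉₊ : ℝ)
      ≤ 102 * Real.log (d / gap I.A) + 100 * Real.log (1 / I.eps) := by
  have hd := h.d_pos; have hg := h.gap_pos
  have hlog2 := Real.log_two_gt_d9
  have h2 := h.log_two_le_log
  have h1 : Real.log (d / I.eps) = Real.log d + Real.log (1 / I.eps) := by
    rw [← Real.log_mul hd.ne' (by positivity), mul_one_div]
  have h3 : Real.log d ≤ Real.log (d / gap I.A) := by
    refine Real.log_le_log hd ?_
    rw [le_div_iff₀ hg]
    exact mul_le_of_le_one_right hd.le h.gap_le_one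
  have h4 : 0 ≤ Real.log (1 / I.eps) := Real.log_nonneg (by rw [le_div_iff₀ hε]; linarith)
  have h5 : 0 ≤ Real.log d := Real.log_nonneg (by linarith [h.two_le'])
  have h6 := Nat.ceil_lt_add_one (a := (100 : ℕ) * Real.log (d / I.eps))
    (by rw [h1]; positivity)
  rw [h1] at h6 ⊢
  push_cast at h6 ⊢
  linarith

theorem srank_pos : 0 < srank I.A := div_pos h.frobSq_pos h.eig_pos

theorem rho_le : I.rho ≤ 500 * √(d * srank I.A / nnz I.A) / gap I.A := by
  have hmu := h.mu_pos; have hL := h.eig_pos; have hg := h.gap_pos; have hF := h.frobSq_pos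
  have hd := h.d_pos; have hn := h.nnz_pos; have hs := h.srank_pos
  have h1 : gap I.A * eig I.A 0 / 165 ≤ I.mu := by
    have := h.le_mu; have := h.le_shift; linarith
  have h2 : I.gamma ≤ 1001 / 1000 * (eig I.A 0 * √(d * srank I.A / nnz I.A)) := by
    refine Real.sqrt_le_iff.2 ⟨by positivity, ?_⟩
    rw [mul_pow, mul_pow, Real.sq_sqrt (by positivity), srank]
    calc (d : ℝ) * I.lamHat * frobSq I.A / nnz I.A
        ≤ d * (1001 / 1000 * eig I.A 0) * frobSq I.A / nnz I.A := by
          gcongr; exact h.lamHat_le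
      _ = 1001 / 1000 * (eig I.A 0 ^ 2 * (d * (frobSq I.A / eig I.A 0) / nnz I.A)) := by
          field_simp
      _ ≤ _ := by gcongr; norm_num
  rw [Input.rho]
  have hga := h.gamma_pos
  calc (2 * I.gamma + I.mu) / I.mu ≤ (2 * I.gamma + 1 / 100 * I.gamma) / I.mu := by
        gcongr; linarith [h.mu_le_gamma]
    _ ≤ (2 * I.gamma + 1 / 100 * I.gamma) / (gap I.A * eig I.A 0 / 165) := by gcongr
    _ = 201 / 100 * 165 * I.gamma / (gap I.A * eig I.A 0) := by field_simp; ring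
    _ ≤ 201 / 100 * 165 * (1001 / 1000 * (eig I.A 0 * √(d * srank I.A / nnz I.A)))
        / (gap I.A * eig I.A 0) := by gcongr
    _ = (201 / 100 * 165 * (1001 / 1000)) * (√(d * srank I.A / nnz I.A) / gap I.A) := by
        field_simp
    _ ≤ 500 * (√(d * srank I.A / nnz I.A) / gap I.A) := by gcongr; norm_num
    _ = _ := by ring

theorem log_rho_le : Real.log I.rho ≤ 10 * Real.log (d / gap I.A) := by
  have hg := h.gap_pos; have hd := h.d_pos; have hn := h.nnz_pos; have hs := h.srank_pos
  have hD := h.two_le_div_gap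
  have h1 : √(d * srank I.A / nnz I.A) ≤ d := by
    refine Real.sqrt_le_iff.2 ⟨hd.le, ?_⟩
    have h2 : srank I.A ≤ d := by
      rw [srank, div_le_iff₀ h.eig_pos]; exact frobSq_le I.A
    rw [div_le_iff₀ hn]
    have h3 : (1 : ℝ) ≤ nnz I.A := by linarith [h.d_le_nnz, h.two_le']
    calc (d : ℝ) * srank I.A ≤ d * d := by gcongr
      _ = (d : ℝ) ^ 2 * 1 := by ring
      _ ≤ _ := by gcongr
  calc Real.log I.rho ≤ Real.log ((d / gap I.A) ^ 10) := by
        refine Real.log_le_log h.rho_pos (h.rho_le.trans ?_)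
        calc _ ≤ 500 * d / gap I.A := by gcongr
          _ = 500 * (d / gap I.A) := by ring
          _ ≤ (d / gap I.A) ^ 9 * (d / gap I.A) := by
            gcongr
            calc (500 : ℝ) ≤ 2 ^ 9 := by norm_num
              _ ≤ _ := by gcongr
          _ = _ := by ring
    _ = _ := by rw [Real.log_pow]; norm_num

theorem nnz_mul_sqrt_rho_le : nnz I.A * √I.rho
    ≤ 23 * ((nnz I.A : ℝ) ^ (3 / 4 : ℝ) * ((d : ℝ) * srank I.A) ^ (1 / 4 : ℝ) / √(gap I.A)) := by
  have hg := h.gap_pos; have hd := h.d_pos; have hn := h.nnz_pos; have hs := h.srank_pos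
  have hX : 0 < (d : ℝ) * srank I.A := by positivity
  have h1 : √I.rho ≤ 23 * (((d : ℝ) * srank I.A / nnz I.A) ^ (1 / 4 : ℝ) / √(gap I.A)) := by
    refine Real.sqrt_le_iff.2 ⟨by positivity, h.rho_le.trans ?_⟩
    have h2 : (((d : ℝ) * srank I.A / nnz I.A) ^ (1 / 4 : ℝ)) ^ 2
        = √(d * srank I.A / nnz I.A) := by
      rw [← Real.rpow_natCast, ← Real.rpow_mul (by positivity), Real.sqrt_eq_rpow]
      norm_num
    rw [mul_pow, div_pow, h2, Real.sq_sqrt hg.le, mul_div_assoc]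
    gcongr
    norm_num
  have h3 : (nnz I.A : ℝ) * ((d : ℝ) * srank I.A / nnz I.A) ^ (1 / 4 : ℝ)
      = (nnz I.A : ℝ) ^ (3 / 4 : ℝ) * ((d : ℝ) * srank I.A) ^ (1 / 4 : ℝ) := by
    rw [Real.div_rpow hX.le hn.le]
    have h4 : (nnz I.A : ℝ) = (nnz I.A : ℝ) ^ (3 / 4 : ℝ) * (nnz I.A : ℝ) ^ (1 / 4 : ℝ) := by
      rw [← Real.rpow_add hn]; norm_num
    nth_rewrite 1 [h4]
    field_simp
  calc nnz I.A * √I.rho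
      ≤ nnz I.A * (23 * (((d : ℝ) * srank I.A / nnz I.A) ^ (1 / 4 : ℝ) / √(gap I.A))) := by gcongr
    _ = 23 * ((nnz I.A * ((d : ℝ) * srank I.A / nnz I.A) ^ (1 / 4 : ℝ)) / √(gap I.A)) := by ring
    _ = _ := by rw [h3]

/-- The time bound, for every outcome of the random draws. -/
theorem costLE_powerMethod (hε : 0 < I.eps) (hε1 : I.eps < 1) (g : Vec d) :
    (I.powerMethod 100 g).CostLE (10 ^ 17
      * ((nnz I.A : ℝ) ^ (3 / 4 : ℝ) * ((d : ℝ) * srank I.A) ^ (1 / 4 : ℝ) / √(gap I.A)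
        * (Real.log (d / gap I.A) ^ 3
          + Real.log (d / gap I.A) * Real.log (1 / I.eps)))) := by
  refine (I.costLE_powerMethod h.costLE_burnInStep h.costLE_warmStep g).mono ?_
  have hw := h.nnz_le_work
  have hd := h.two_le'
  have hn := h.d_le_nnz
  have hN := h.burnInCount_le
  have hT := h.mainCount_le hε hε1
  have hlr := h.log_rho_le
  have hsr := h.nnz_mul_sqrt_rho_le
  have hlog2 := Real.log_two_gt_d9
  have hl2 := h.log_two_le_log
  have hle : 0 ≤ Real.log (1 / I.eps) := Real.log_nonneg (by rw [le_div_iff₀ hε]; linarith)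
  set l := Real.log (d / gap I.A)
  set e := Real.log (1 / I.eps)
  set Y := (nnz I.A : ℝ) ^ (3 / 4 : ℝ) * ((d : ℝ) * srank I.A) ^ (1 / 4 : ℝ) / √(gap I.A)
  have hWY : √I.rho * Real.log I.rho * nnz I.A ≤ 230 * (Y * l) := by
    have h0 := h.log_rho_pos
    calc _ = nnz I.A * √I.rho * Real.log I.rho := by ring
      _ ≤ 23 * Y * (10 * l) := by
          refine mul_le_mul hsr hlr h0.le ?_
          exact le_trans (by positivity) hsr
      _ = _ := by ring
  set W := √I.rho * Real.log I.rho * nnz I.A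
  have hW1 : 1 ≤ W := by linarith
  have hl : 69 / 100 ≤ l := by linarith
  have hN1 : (I.burnInCount 100 : ℝ) + 1 ≤ 204 * l := by linarith
  have hl1 : 1 ≤ 3 * l ^ 2 := by nlinarith
  have hl3 : l ≤ 2 * l ^ 2 := by nlinarith
  calc _ ≤ 100 * W * (3 * l ^ 2) + 202 * l * (204 * l * (4 * 10 ^ 8 * W) + l * 2 * W)
        + (102 * (2 * l ^ 2) + 100 * e) * (4 * 10 ^ 10 * W + W) := by
        have h1 : 1 ≤ l * 2 * W := by nlinarith
        have h2 : 10 * (nnz I.A : ℝ) + 4 * d + 102 ≤ 100 * W * (3 * l ^ 2) := by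
          have : W ≤ W * (3 * l ^ 2) := le_mul_of_one_le_right (by linarith) hl1
          linarith
        gcongr
        exact hT.trans (by linarith)
    _ ≤ 10 ^ 14 * (W * (l ^ 2 + e)) := by
        have h1 : 0 ≤ W * l ^ 2 := by positivity
        have h2 : 0 ≤ W * e := by positivity
        nlinarith
    _ ≤ 10 ^ 14 * (230 * (Y * l) * (l ^ 2 + e)) := by gcongr
    _ = (10 ^ 14 * 230) * (Y * (l ^ 3 + l * e)) := by ring
    _ ≤ _ := by
        have hY : 0 ≤ Y := by
          have : (0 : ℝ) ≤ nnz I.A * √I.rho := by positivity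
          linarith
        gcongr
        norm_num

end Regime

end ShiftInvert

end

theorem mainTheorem2 :
    ∃ (K : ℕ) (C : ℝ), 0 < C ∧
      ∀ (n d : ℕ) (A : Matrix (Fin n) (Fin d) ℝ) (hA : A ≠ 0) (lam lamHat ε : ℝ)
        (v₁ : ShiftInvert.Vec d),
        2 ≤ d →
        0 < ShiftInvert.gap A →
        d ≤ ShiftInvert.nnz A →
        (ShiftInvert.nnz A : ℝ) ≤ d * ShiftInvert.srank A / ShiftInvert.gap A ^ 2 →
        (1 + ShiftInvert.gap A / 150) * ShiftInvert.eig A 0 ≤ lam →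
        lam ≤ (1 + ShiftInvert.gap A / 100) * ShiftInvert.eig A 0 →
        10 / 11 * (lam - ShiftInvert.eig A 0) ≤ lam - lamHat →
        lam - lamHat ≤ lam - ShiftInvert.eig A 0 →
        0 < ε → ε < 1 →
        ‖v₁‖ = 1 →
        ShiftInvert.gramMul A v₁ = ShiftInvert.eig A 0 • v₁ →
        (1 - ENNReal.ofReal (C / (d : ℝ) ^ 10) ≤
          (ShiftInvert.Input.mk A hA lam lamHat ε).successProb K
            {x | ‖x‖ = 1 ∧ 1 - ε ≤ |inner ℝ v₁ x|}) ∧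
        (∀ (g : ShiftInvert.Vec d),
          ∀ r ∈ ((ShiftInvert.Input.mk A hA lam lamHat ε).powerMethod K g).outcomes,
            (r.2 : ℝ) ≤
              C * ((ShiftInvert.nnz A : ℝ) ^ (3 / 4 : ℝ)
                  * ((d : ℝ) * ShiftInvert.srank A) ^ (1 / 4 : ℝ) / √(ShiftInvert.gap A)
                * (Real.log (d / ShiftInvert.gap A) ^ 3
                  + Real.log (d / ShiftInvert.gap A) * Real.log (1 / ε)))) := by
  refine ⟨100, 10 ^ 17, by norm_num, ?_⟩
  intro n d A hA lam lamHat ε v₁ hd hgap hnnz hnnz' hlam hlam' hmu hmu' hε hε1 hv hev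
  have h : ShiftInvert.Regime (ShiftInvert.Input.mk A hA lam lamHat ε) v₁ :=
    ⟨hd, hgap, hnnz, hnnz', hlam, hlam', hmu, hmu', hv, hev⟩
  refine ⟨le_trans (tsub_le_tsub_left (ENNReal.ofReal_le_ofReal ?_) 1) (h.le_successProb hε hε1),
    fun g => h.costLE_powerMethod hε hε1 g⟩
  gcongr
  norm_num
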